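/- Let $\mathbb N=\{1,2,\dots\}$, let the scalar field $\mathbb K$ be $\mathbb R$ or $\mathbb C$, and let $c_{00}$ be the space of finitely supported scalar sequences, with canonical basis $(e_i)_{i=1}^\infty$. For sets of positive integers, $E<F$ means $\max E<\min F$; $t\le E$ means $t\le\min E$ (with $t\le\varnothing$ for all $t$); $Ex$ denotes the restriction of the sequence $x$ to $E$. *Schreier families.* For each countable limit ordinal $\xi$ fix a sequence of ordinals $\xi_n<\xi$ with $\xi_n\uparrow\xi$. Let $\mathcal S_0=\{\varnothing\}\cup\{\{n\}:n\in\mathbb N\}$, let $$\mathcal S_{\xi+1}=\{\varnothing\}\cup\Bigl\{\bigcup_{j=1}^tE_j: t\le E_1<\dots<E_t,\ \varnothing\ne E_j\in\mathcal S_\xi\Bigr\},$$ and, for limit $\xi$, let $\mathcal S_\xi=\{\varnothing\}\cup\{E:\exists n\le E,\ E\in\mathcal S_{\xi_n}\}$. *Spaces.* For $\gamma<\omega_1$ let $\|x\|_{X_\gamma}=\sup\{\sum_{i\in E}|x_i|:E\in\mathcal S_\gamma\}$, let the Schreier space $X_\gamma$ be the completion of $c_{00}$ in this norm, and let $$\|x\|_{X_\gamma^2}=\sup\Bigl\{\Bigl(\sum_{n=1}^\infty\|E_nx\|_{X_\gamma}^2\Bigr)^{1/2}:E_1<E_2<\cdots\Bigr\}.$$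 Fix $\alpha,\beta<\omega_1$ and a sequence $(f_i)_{i=1}^\infty$ that is dense in the unit sphere of $X_\alpha$. Let $G_{\alpha,\beta}$ be the completion of $c_{00}$ in the norm $$\Bigl\|\sum_ia_ie_i\Bigr\|_{G_{\alpha,\beta}}=\sup\Bigl\{\Bigl\|\sum_{n=1}^\infty\Bigl\|\sum_{i\in I_n}a_if_i\Bigr\|_{X_\alpha}e_{\min I_n}\Bigr\|_{X_\beta^2}:I_1<I_2<\cdots\text{ intervals in }\mathbb N\Bigr\}.$$ **Proposition 3.2.** (i) $(e_i)$ is a Schauder basis of $G_{\alpha,\beta}$ which is normalized ($\|e_i\|=1$ for all $i$), bimonotone (for all $p\le q$ the basis projection $\sum_i a_ie_i\mapsto\sum_{i=p}^qa_ie_i$ has norm at most $1$), and boundedly complete (for any scalars $(a_i)$ with $\sup_n\|\sum_{i=1}^na_ie_i\|<\infty$, the series $\sum_ia_ie_i$ converges in $G_{\alpha,\beta}$). (ii) Whenever $g=\sum_{i=1}^\infty a_ie_i\in G_{\alpha,\beta}$ (convergent series), the series $\sum_{i=1}^\infty a_if_i$ converges in $X_\alpha$, and $Qg:=\sum_{i=1}^\infty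 a_if_i$ defines a bounded linear operator $Q:G_{\alpha,\beta}\to X_\alpha$ with $\|Q\|=1$. Moreover $Q$ is a quotient map: it maps the open unit ball of $G_{\alpha,\beta}$ onto the open unit ball of $X_\alpha$ (in particular $Q$ is onto, and the norm of $X_\alpha$ is the quotient norm). -/

import Mathlib

open Set Filter Topology
open scoped ENNReal

noncomputable section

namespace Lindenstrauss

/-! ### Schreier families -/

/-- `Before E F` is the relation `E < F` (that is, `max E < min F`) between non-empty finite sets
of positive integers. -/
def Before (E F : Finset ℕ+) : Prop := ∀ i ∈ E, ∀ j ∈ F, i < j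

/-- `s` chooses, for each countable limit ordinal `ξ`, a sequence `s ξ 1, s ξ 2, …` of smaller
ordinals which increases to `ξ`. -/
def IsFundamentalSystem (s : Ordinal.{0} → ℕ+ → Ordinal.{0}) : Prop :=
  ∀ ξ, ξ < Ordinal.omega 1 → Order.IsSuccLimit ξ →
    Monotone (s ξ) ∧ (∀ n, s ξ n < ξ) ∧ IsLUB (range (s ξ)) ξ

/-- `MemSchreier s ξ E` says that `E` belongs to the Schreier family `𝒮_ξ` built from the
fundamental sequences `s`. The recursion `𝒮_0`, `𝒮_{ξ+1}`, `𝒮_ξ` (`ξ` limit) is spelled out in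
`memSchreier_zero`, `memSchreier_succ` and `memSchreier_limit`. -/
inductive MemSchreier (s : Ordinal.{0} → ℕ+ → Ordinal.{0}) : Ordinal.{0} → Finset ℕ+ → Prop
  | empty (ξ : Ordinal.{0}) : MemSchreier s ξ ∅
  | singleton (n : ℕ+) : MemSchreier s 0 {n}
  | union (ξ : Ordinal.{0}) (t : ℕ) (F : Fin t → Finset ℕ+)
      (hF : ∀ j, MemSchreier s ξ (F j)) (hne : ∀ j, (F j).Nonempty)
      (hlt : ∀ j k, j < k → Before (F j) (F k))
      (ht : ∀ j, ∀ i ∈ F j, t ≤ (i : ℕ)) :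
      MemSchreier s (ξ + 1) (Finset.univ.biUnion F)
  | limit (ξ : Ordinal.{0}) (hξ : Order.IsSuccLimit ξ) (n : ℕ+) (E : Finset ℕ+)
      (hn : ∀ i ∈ E, n ≤ i) (hE : MemSchreier s (s ξ n) E) : MemSchreier s ξ E

/-- The Schreier family `𝒮_ξ`. -/
def schreierFamily (s : Ordinal.{0} → ℕ+ → Ordinal.{0}) (ξ : Ordinal.{0}) : Set (Finset ℕ+) :=
  {E | MemSchreier s ξ E}

theorem memSchreier_zero (s : Ordinal.{0} → ℕ+ → Ordinal.{0}) (E : Finset ℕ+) :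
    E ∈ schreierFamily s 0 ↔ E = ∅ ∨ ∃ n, E = {n} := by
  constructor
  · intro h
    generalize hz : (0 : Ordinal.{0}) = z at h
    cases h with
    | empty => exact Or.inl rfl
    | singleton n => exact Or.inr ⟨n, rfl⟩
    | union ξ t F hF hne hlt ht => exact absurd hz.symm (Order.succ_ne_bot ξ)
    | limit _ hξ n _ hn hE => subst hz; exact absurd hξ (by simp)
  · rintro (rfl | ⟨n, rfl⟩)
    · exact .empty 0
    · exact .singleton n

theorem memSchreier_succ (s : Ordinal.{0} → ℕ+ → Ordinal.{0}) (ξ : Ordinal.{0}) (E : Finset ℕ+) :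
    E ∈ schreierFamily s (ξ + 1) ↔ E = ∅ ∨ ∃ (t : ℕ) (F : Fin t → Finset ℕ+),
      (∀ j, F j ∈ schreierFamily s ξ ∧ (F j).Nonempty) ∧ (∀ j k, j < k → Before (F j) (F k)) ∧
      (∀ j, ∀ i ∈ F j, t ≤ (i : ℕ)) ∧ E = Finset.univ.biUnion F := by
  constructor
  · intro h
    generalize hz : ξ + 1 = z at h
    cases h with
    | empty => exact Or.inl rfl
    | singleton n => exact absurd hz (Order.succ_ne_bot ξ)
    | union ξ' t F hF hne hlt ht =>
      obtain rfl := Order.succ_injective hz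
      exact Or.inr ⟨t, F, fun j => ⟨hF j, hne j⟩, hlt, ht, rfl⟩
    | limit _ hξ n _ hn hE =>
      subst hz
      exact absurd hξ (Order.not_isSuccLimit_succ ξ)
  · rintro (rfl | ⟨t, F, hF, hlt, ht, rfl⟩)
    · exact .empty _
    · exact .union ξ t F (fun j => (hF j).1) (fun j => (hF j).2) hlt ht

theorem memSchreier_limit (s : Ordinal.{0} → ℕ+ → Ordinal.{0}) (ξ : Ordinal.{0})
    (hξ : Order.IsSuccLimit ξ) (E : Finset ℕ+) :
    E ∈ schreierFamily s ξ ↔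
      E = ∅ ∨ ∃ n : ℕ+, (∀ i ∈ E, n ≤ i) ∧ E ∈ schreierFamily s (s ξ n) := by
  constructor
  · intro h
    cases h with
    | empty => exact Or.inl rfl
    | singleton n => exact absurd hξ (by simp)
    | union ξ' t F hF hne hlt ht => exact absurd hξ (Order.not_isSuccLimit_succ ξ')
    | limit _ hξ n _ hn hE => exact Or.inr ⟨n, hn, hE⟩
  · rintro (rfl | ⟨n, hn, hE⟩)
    · exact .empty ξ
    · exact .limit ξ hξ n E hn hE

/-! ### The norms

All norms are first defined with values in `[0, ∞]`, for arbitrary sequences; they are then shown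
to be finite on `c₀₀`. -/

section Norms

variable {E : Type*} [NormedAddCommGroup E]

/-- The Schreier norm `sup {‖A x‖_{ℓ₁} : A ∈ 𝓕}` of a sequence `x`. -/
def schreierENorm (𝓕 : Set (Finset ℕ+)) (x : ℕ+ → E) : ℝ≥0∞ :=
  ⨆ A ∈ 𝓕, ∑ i ∈ A, ‖x i‖ₑ

/-- `A 0 < A 1 < A 2 < …` are non-empty finite sets. -/
def IsSuccessive (A : ℕ → Finset ℕ+) : Prop :=
  (∀ n, (A n).Nonempty) ∧ ∀ n, Before (A n) (A (n + 1))

/-- The Baernstein `2` norm `sup {(∑ₙ ‖Aₙ x‖²)^{1/2} : A₁ < A₂ < …}` of a sequence `x`, where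
`‖·‖` is the Schreier norm of the family `𝓕`. -/
def baernsteinENorm (𝓕 : Set (Finset ℕ+)) (x : ℕ+ → E) : ℝ≥0∞ :=
  ⨆ (A : ℕ → Finset ℕ+) (_ : IsSuccessive A),
    (∑' n, schreierENorm 𝓕 (Set.indicator (A n : Set ℕ+) x) ^ 2) ^ (1 / 2 : ℝ)

/-- `[p 0, q 0] < [p 1, q 1] < …` are non-empty intervals of positive integers. -/
def IsIntervalSeq (p q : ℕ → ℕ+) : Prop :=
  (∀ n, p n ≤ q n) ∧ ∀ n, q n < p (n + 1)

/-- The sequence `∑ₙ cₙ e_{p n}`: its `p n`-th entry is `c n` (for injective `p`), and all its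
other entries are `0`. -/
def spread (p : ℕ → ℕ+) (c : ℕ → ℝ) : ℕ+ → ℝ := Function.extend p c 0

/-- For intervals `Iₙ = [p n, q n]` and a sequence `x` in a normed space, the sequence
`∑ₙ ‖∑_{i ∈ Iₙ} x i‖ e_{min Iₙ}`. -/
def blockVector (p q : ℕ → ℕ+) (x : ℕ+ → E) : ℕ+ → ℝ :=
  spread p fun n => ‖∑ i ∈ Finset.Icc (p n) (q n), x i‖

/-- The supremum over all intervals `I₁ < I₂ < …` of the Baernstein `2` norm of
`∑ₙ ‖∑_{i ∈ Iₙ} x i‖ e_{min Iₙ}`. -/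
def intervalENorm (𝓕 : Set (Finset ℕ+)) (x : ℕ+ → E) : ℝ≥0∞ :=
  ⨆ (p : ℕ → ℕ+) (q : ℕ → ℕ+) (_ : IsIntervalSeq p q), baernsteinENorm 𝓕 (blockVector p q x)

/-! #### The norm axioms -/

theorem IsIntervalSeq.isSuccessive {p q : ℕ → ℕ+} (h : IsIntervalSeq p q) :
    IsSuccessive fun n => Finset.Icc (p n) (q n) := by
  refine ⟨fun n => Finset.nonempty_Icc.2 (h.1 n), fun n i hi j hj => ?_⟩
  exact ((Finset.mem_Icc.1 hi).2.trans_lt (h.2 n)).trans_le (Finset.mem_Icc.1 hj).1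

theorem IsIntervalSeq.injective {p q : ℕ → ℕ+} (h : IsIntervalSeq p q) :
    Function.Injective p :=
  (strictMono_nat_of_lt_succ fun n => (h.1 n).trans_lt (h.2 n)).injective

theorem IsSuccessive.disjoint {A : ℕ → Finset ℕ+} (h : IsSuccessive A) {m n : ℕ} {i : ℕ+}
    (hm : i ∈ A m) (hn : i ∈ A n) : m = n := by
  have key : ∀ m k, ∀ a ∈ A m, ∀ b ∈ A (m + 1 + k), a < b := by
    intro m k
    induction k with
    | zero => intro a ha b hb; exact h.2 m a ha b hb
    | succ k ih =>
      intro a ha b hb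
      obtain ⟨c, hc⟩ := h.1 (m + 1 + k)
      exact (ih a ha c hc).trans (h.2 _ c hc b hb)
  rcases lt_trichotomy m n with hlt | heq | hlt
  · obtain ⟨k, rfl⟩ := Nat.exists_eq_add_of_lt hlt
    exact absurd (key m k i hm i (by convert hn using 2; omega)) (lt_irrefl _)
  · exact heq
  · obtain ⟨k, rfl⟩ := Nat.exists_eq_add_of_lt hlt
    exact absurd (key n k i hn i (by convert hm using 2; omega)) (lt_irrefl _)

theorem IsSuccessive.tsum_sum_le {A : ℕ → Finset ℕ+} (h : IsSuccessive A) (w : ℕ+ → ℝ≥0∞) :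
    ∑' n, ∑ i ∈ A n, w i ≤ ∑' i, w i := by
  have e : ∀ n, ∑ i ∈ A n, w i = ∑' i, (if i ∈ A n then w i else 0) := by
    intro n
    rw [tsum_eq_sum (s := A n) (by intro b hb; simp [hb])]
    exact Finset.sum_congr rfl fun i hi => by simp [hi]
  simp_rw [e]
  rw [ENNReal.tsum_comm]
  refine ENNReal.tsum_le_tsum fun i => ?_
  by_cases hi : ∃ m, i ∈ A m
  · obtain ⟨m, hm⟩ := hi
    rw [tsum_eq_single m]
    · simp [hm]
    · intro n hn
      rw [if_neg]
      exact fun hin => hn (h.disjoint hin hm)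
  · push Not at hi
    simp [hi]

theorem schreierENorm_mono {E' : Type*} [NormedAddCommGroup E'] (𝓕 : Set (Finset ℕ+))
    {x : ℕ+ → E} {y : ℕ+ → E'} (h : ∀ i, ‖x i‖ₑ ≤ ‖y i‖ₑ) :
    schreierENorm 𝓕 x ≤ schreierENorm 𝓕 y :=
  iSup₂_mono fun _ _ => Finset.sum_le_sum fun i _ => h i

theorem schreierENorm_add (𝓕 : Set (Finset ℕ+)) (x y : ℕ+ → E) :
    schreierENorm 𝓕 (x + y) ≤ schreierENorm 𝓕 x + schreierENorm 𝓕 y := by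
  refine iSup₂_le fun A hA => ?_
  calc ∑ i ∈ A, ‖(x + y) i‖ₑ ≤ ∑ i ∈ A, (‖x i‖ₑ + ‖y i‖ₑ) :=
        Finset.sum_le_sum fun i _ => enorm_add_le _ _
    _ = ∑ i ∈ A, ‖x i‖ₑ + ∑ i ∈ A, ‖y i‖ₑ := Finset.sum_add_distrib
    _ ≤ _ := add_le_add (le_iSup₂ (f := fun (A : Finset ℕ+) (_ : A ∈ 𝓕) => ∑ i ∈ A, ‖x i‖ₑ) A hA)
        (le_iSup₂ (f := fun (A : Finset ℕ+) (_ : A ∈ 𝓕) => ∑ i ∈ A, ‖y i‖ₑ) A hA)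

theorem schreierENorm_smul_le {𝕜 : Type*} [NormedField 𝕜] [NormedSpace 𝕜 E]
    (𝓕 : Set (Finset ℕ+)) (c : 𝕜) (x : ℕ+ → E) :
    schreierENorm 𝓕 (c • x) ≤ ‖c‖ₑ * schreierENorm 𝓕 x := by
  refine iSup₂_le fun A hA => ?_
  simp_rw [Pi.smul_apply, enorm_smul, ← Finset.mul_sum]
  gcongr
  exact le_iSup₂ (f := fun (A : Finset ℕ+) (_ : A ∈ 𝓕) => ∑ i ∈ A, ‖x i‖ₑ) A hA

theorem schreierENorm_le_tsum (𝓕 : Set (Finset ℕ+)) (x : ℕ+ → E) :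
    schreierENorm 𝓕 x ≤ ∑' i, ‖x i‖ₑ :=
  iSup₂_le fun A _ => ENNReal.sum_le_tsum A

theorem schreierENorm_indicator_le (𝓕 : Set (Finset ℕ+)) (A : Finset ℕ+) (x : ℕ+ → E) :
    schreierENorm 𝓕 (Set.indicator (A : Set ℕ+) x) ≤ ∑ i ∈ A, ‖x i‖ₑ := by
  refine (schreierENorm_le_tsum _ _).trans_eq ?_
  rw [tsum_eq_sum (s := A) (by intro b hb; simp [hb])]
  exact Finset.sum_congr rfl fun i hi => by simp [hi]

theorem sqrt_tsum_add_le (u v : ℕ → ℝ≥0∞) :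
    (∑' n, (u n + v n) ^ 2) ^ (1 / 2 : ℝ) ≤
      (∑' n, u n ^ 2) ^ (1 / 2 : ℝ) + (∑' n, v n ^ 2) ^ (1 / 2 : ℝ) := by
  have key : ∀ (a b : ℝ≥0∞), a ^ (1 / 2 : ℝ) ≤ b ↔ a ≤ b ^ (2 : ℝ) := by
    intro a b
    rw [one_div]
    exact ENNReal.rpow_inv_le_iff two_pos
  rw [key, ENNReal.tsum_eq_iSup_sum]
  refine iSup_le fun t => ?_
  rw [← key]
  have := ENNReal.Lp_add_le t u v (p := 2) (by norm_num)
  simp only [ENNReal.rpow_two] at this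
  refine this.trans ?_
  gcongr <;> exact ENNReal.sum_le_tsum t

theorem sqrt_tsum_le (u : ℕ → ℝ≥0∞) : (∑' n, u n ^ 2) ^ (1 / 2 : ℝ) ≤ ∑' n, u n := by
  rw [one_div, ENNReal.rpow_inv_le_iff two_pos, ENNReal.rpow_two, sq, ← ENNReal.tsum_mul_right]
  refine ENNReal.tsum_le_tsum fun n => ?_
  rw [sq]
  gcongr
  exact ENNReal.le_tsum n

theorem le_baernsteinENorm (𝓕 : Set (Finset ℕ+)) (x : ℕ+ → E) {A : ℕ → Finset ℕ+}
    (hA : IsSuccessive A) :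
    (∑' n, schreierENorm 𝓕 (Set.indicator (A n : Set ℕ+) x) ^ 2) ^ (1 / 2 : ℝ) ≤
      baernsteinENorm 𝓕 x :=
  le_iSup₂ (f := fun (A : ℕ → Finset ℕ+) (_ : IsSuccessive A) =>
    (∑' n, schreierENorm 𝓕 (Set.indicator (A n : Set ℕ+) x) ^ 2) ^ (1 / 2 : ℝ)) A hA

theorem baernsteinENorm_mono {E' : Type*} [NormedAddCommGroup E'] (𝓕 : Set (Finset ℕ+))
    {x : ℕ+ → E} {y : ℕ+ → E'} (h : ∀ i, ‖x i‖ₑ ≤ ‖y i‖ₑ) :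
    baernsteinENorm 𝓕 x ≤ baernsteinENorm 𝓕 y := by
  refine iSup₂_mono fun A _ => ?_
  gcongr with n
  refine schreierENorm_mono 𝓕 fun i => ?_
  by_cases hi : i ∈ A n
  · simpa [hi] using h i
  · simp [hi]

theorem baernsteinENorm_add (𝓕 : Set (Finset ℕ+)) (x y : ℕ+ → E) :
    baernsteinENorm 𝓕 (x + y) ≤ baernsteinENorm 𝓕 x + baernsteinENorm 𝓕 y := by
  refine iSup₂_le fun A hA => ?_
  refine le_trans ?_ ((sqrt_tsum_add_le _ _).trans
    (add_le_add (le_baernsteinENorm 𝓕 x hA) (le_baernsteinENorm 𝓕 y hA)))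
  gcongr with n
  rw [Set.indicator_add']
  exact schreierENorm_add 𝓕 _ _

theorem baernsteinENorm_smul_le {𝕜 : Type*} [NormedField 𝕜] [NormedSpace 𝕜 E]
    (𝓕 : Set (Finset ℕ+)) (c : 𝕜) (x : ℕ+ → E) :
    baernsteinENorm 𝓕 (c • x) ≤ ‖c‖ₑ * baernsteinENorm 𝓕 x := by
  refine iSup₂_le fun A hA => ?_
  have h1 : ∀ n, schreierENorm 𝓕 (Set.indicator (A n : Set ℕ+) (c • x)) ^ 2 ≤
      ‖c‖ₑ ^ 2 * schreierENorm 𝓕 (Set.indicator (A n : Set ℕ+) x) ^ 2 := by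
    intro n
    rw [← mul_pow]
    gcongr
    refine le_trans (le_of_eq ?_) (schreierENorm_smul_le 𝓕 c _)
    congr 1
    exact Set.indicator_const_smul _ c x
  calc _ ≤ (∑' n, ‖c‖ₑ ^ 2 * schreierENorm 𝓕 (Set.indicator (A n : Set ℕ+) x) ^ 2)
          ^ (1 / 2 : ℝ) := by gcongr with n; exact h1 n
    _ = ‖c‖ₑ * (∑' n, schreierENorm 𝓕 (Set.indicator (A n : Set ℕ+) x) ^ 2) ^ (1 / 2 : ℝ) := by
        rw [ENNReal.tsum_mul_left, ENNReal.mul_rpow_of_nonneg _ _ (by norm_num),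
          ← ENNReal.rpow_two, ← ENNReal.rpow_mul]
        norm_num
    _ ≤ _ := by gcongr; exact le_baernsteinENorm 𝓕 x hA

theorem baernsteinENorm_le_tsum (𝓕 : Set (Finset ℕ+)) (x : ℕ+ → E) :
    baernsteinENorm 𝓕 x ≤ ∑' i, ‖x i‖ₑ := by
  refine iSup₂_le fun A hA => (sqrt_tsum_le _).trans (le_trans ?_ (hA.tsum_sum_le _))
  exact ENNReal.tsum_le_tsum fun n => schreierENorm_indicator_le 𝓕 (A n) x

theorem le_intervalENorm (𝓕 : Set (Finset ℕ+)) (x : ℕ+ → E) {p q : ℕ → ℕ+}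
    (h : IsIntervalSeq p q) : baernsteinENorm 𝓕 (blockVector p q x) ≤ intervalENorm 𝓕 x :=
  le_iSup_of_le p (le_iSup₂ (f := fun (q : ℕ → ℕ+) (_ : IsIntervalSeq p q) =>
    baernsteinENorm 𝓕 (blockVector p q x)) q h)

theorem intervalENorm_le {𝓕 : Set (Finset ℕ+)} {x : ℕ+ → E} {C : ℝ≥0∞}
    (h : ∀ p q, IsIntervalSeq p q → baernsteinENorm 𝓕 (blockVector p q x) ≤ C) :
    intervalENorm 𝓕 x ≤ C :=
  iSup_le fun p => iSup₂_le fun q hpq => h p q hpq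

theorem blockVector_apply {p q : ℕ → ℕ+} (h : IsIntervalSeq p q) (x : ℕ+ → E) (n : ℕ) :
    blockVector p q x (p n) = ‖∑ i ∈ Finset.Icc (p n) (q n), x i‖ := by
  unfold blockVector spread
  exact h.injective.extend_apply _ _ _

theorem blockVector_apply_of_notMem {p q : ℕ → ℕ+} (x : ℕ+ → E) {k : ℕ+}
    (hk : ¬ ∃ n, p n = k) : blockVector p q x k = 0 := by
  unfold blockVector spread
  exact Function.extend_apply' _ _ _ hk

theorem intervalENorm_add (𝓕 : Set (Finset ℕ+)) (x y : ℕ+ → E) :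
    intervalENorm 𝓕 (x + y) ≤ intervalENorm 𝓕 x + intervalENorm 𝓕 y := by
  refine intervalENorm_le fun p q h => ?_
  refine le_trans (baernsteinENorm_mono 𝓕 (y := blockVector p q x + blockVector p q y) ?_)
    ((baernsteinENorm_add 𝓕 _ _).trans
      (add_le_add (le_intervalENorm 𝓕 x h) (le_intervalENorm 𝓕 y h)))
  intro k
  by_cases hk : ∃ n, p n = k
  · obtain ⟨n, rfl⟩ := hk
    rw [Pi.add_apply, blockVector_apply h, blockVector_apply h, blockVector_apply h,
      enorm_le_iff_norm_le, norm_norm, Real.norm_of_nonneg (by positivity)]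
    simp only [Pi.add_apply, Finset.sum_add_distrib]
    exact norm_add_le _ _
  · simp [blockVector_apply_of_notMem _ hk]

theorem intervalENorm_smul_le {𝕜 : Type*} [NormedField 𝕜] [NormedSpace 𝕜 E]
    (𝓕 : Set (Finset ℕ+)) (c : 𝕜) (x : ℕ+ → E) :
    intervalENorm 𝓕 (c • x) ≤ ‖c‖ₑ * intervalENorm 𝓕 x := by
  refine intervalENorm_le fun p q h => ?_
  have e : ‖c‖ₑ = ‖(‖c‖ : ℝ)‖ₑ := by simp
  refine le_trans (baernsteinENorm_mono 𝓕 (y := ‖c‖ • blockVector p q x) ?_)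
    ((baernsteinENorm_smul_le 𝓕 _ _).trans ?_)
  · intro k
    by_cases hk : ∃ n, p n = k
    · obtain ⟨n, rfl⟩ := hk
      rw [Pi.smul_apply, blockVector_apply h, blockVector_apply h]
      simp only [Pi.smul_apply, ← Finset.smul_sum, norm_smul, smul_eq_mul, le_refl]
    · simp [blockVector_apply_of_notMem _ hk]
  · rw [← e]
    gcongr
    exact le_intervalENorm 𝓕 x h

theorem intervalENorm_le_tsum (𝓕 : Set (Finset ℕ+)) (x : ℕ+ → E) :
    intervalENorm 𝓕 x ≤ ∑' i, ‖x i‖ₑ := by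
  refine intervalENorm_le fun p q h => (baernsteinENorm_le_tsum 𝓕 _).trans ?_
  refine le_trans ?_ (h.isSuccessive.tsum_sum_le _)
  have : ∑' n, ‖blockVector p q x (p n)‖ₑ = ∑' k, ‖blockVector p q x k‖ₑ := by
    refine h.injective.tsum_eq (f := fun k => ‖blockVector p q x k‖ₑ) ?_
    intro k hk
    by_contra hk'
    exact hk (by simp [blockVector_apply_of_notMem x (p := p) (q := q) hk'])
  rw [← this]
  refine ENNReal.tsum_le_tsum fun n => ?_
  rw [blockVector_apply h, enorm_norm]
  exact enorm_sum_le _ _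

end Norms

/-! ### The spaces -/

section Spaces

variable {𝕜 : Type*} [RCLike 𝕜]

theorem tsum_enorm_smul_lt_top {E : Type*} [NormedAddCommGroup E] [NormedSpace 𝕜 E]
    (f : ℕ+ → E) (a : ℕ+ →₀ 𝕜) : ∑' i, ‖a i • f i‖ₑ < ∞ := by
  rw [tsum_eq_sum (s := a.support) (by intro b hb; simp [Finsupp.notMem_support_iff.1 hb])]
  exact ENNReal.sum_lt_top.2 fun i _ => enorm_lt_top

/-- The norm `‖·‖_{X_γ}` on `c₀₀`, for `𝓕 = 𝒮_γ`. -/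
def schreierSeminorm (𝕜 : Type*) [RCLike 𝕜] (𝓕 : Set (Finset ℕ+)) : Seminorm 𝕜 (ℕ+ →₀ 𝕜) :=
  Seminorm.ofSMulLE (fun a => (schreierENorm 𝓕 fun i => a i).toReal)
    (by
      have h := schreierENorm_le_tsum 𝓕 (fun _ : ℕ+ => (0 : 𝕜))
      simp only [enorm_zero, tsum_zero, nonpos_iff_eq_zero] at h
      simp [h])
    (by
      intro a b
      have fin : ∀ a : ℕ+ →₀ 𝕜, schreierENorm 𝓕 (fun i => a i) ≠ ∞ := fun a =>
        ((schreierENorm_le_tsum _ _).trans_lt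
          (by simpa using tsum_enorm_smul_lt_top (fun _ => (1 : 𝕜)) a)).ne
      rw [← ENNReal.toReal_add (fin a) (fin b)]
      exact ENNReal.toReal_mono (ENNReal.add_ne_top.2 ⟨fin a, fin b⟩) (schreierENorm_add 𝓕 _ _))
    (by
      intro c a
      have fin : schreierENorm 𝓕 (fun i => a i) ≠ ∞ :=
        ((schreierENorm_le_tsum _ _).trans_lt
          (by simpa using tsum_enorm_smul_lt_top (fun _ => (1 : 𝕜)) a)).ne
      rw [← toReal_enorm c, ← ENNReal.toReal_mul]
      exact ENNReal.toReal_mono (ENNReal.mul_ne_top enorm_ne_top fin)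
        (schreierENorm_smul_le 𝓕 c _))

/-- For a sequence `f` in a normed space `X`, the norm on `c₀₀` which sends `∑ aᵢ eᵢ` to the
supremum over all intervals `I₁ < I₂ < …` of the Baernstein `2` norm of
`∑ₙ ‖∑_{i ∈ Iₙ} aᵢ fᵢ‖ e_{min Iₙ}`. -/
def intervalSeminorm {X : Type*} [NormedAddCommGroup X] [NormedSpace 𝕜 X]
    (𝓕 : Set (Finset ℕ+)) (f : ℕ+ → X) : Seminorm 𝕜 (ℕ+ →₀ 𝕜) :=
  Seminorm.ofSMulLE (fun a => (intervalENorm 𝓕 fun i => a i • f i).toReal)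
    (by
      have h := intervalENorm_le_tsum 𝓕 (fun _ : ℕ+ => (0 : X))
      simp only [enorm_zero, tsum_zero, nonpos_iff_eq_zero] at h
      simp [h])
    (by
      intro a b
      have fin : ∀ a : ℕ+ →₀ 𝕜, intervalENorm 𝓕 (fun i => a i • f i) ≠ ∞ := fun a =>
        ((intervalENorm_le_tsum _ _).trans_lt (tsum_enorm_smul_lt_top f a)).ne
      rw [← ENNReal.toReal_add (fin a) (fin b)]
      refine ENNReal.toReal_mono (ENNReal.add_ne_top.2 ⟨fin a, fin b⟩)
        (le_trans (le_of_eq ?_) (intervalENorm_add 𝓕 _ _))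
      congr 1
      ext i
      simp [add_smul])
    (by
      intro c a
      have fin : intervalENorm 𝓕 (fun i => a i • f i) ≠ ∞ :=
        ((intervalENorm_le_tsum _ _).trans_lt (tsum_enorm_smul_lt_top f a)).ne
      rw [← toReal_enorm c, ← ENNReal.toReal_mul]
      refine ENNReal.toReal_mono (ENNReal.mul_ne_top enorm_ne_top fin)
        (le_trans (le_of_eq ?_) (intervalENorm_smul_le 𝓕 c _))
      congr 1
      ext i
      simp [mul_smul])

/-- The space `c₀₀` of finitely supported scalar sequences `(aᵢ)_{i ≥ 1}`, equipped with the
(semi)norm `ν`. -/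
def C00 (_ν : Seminorm 𝕜 (ℕ+ →₀ 𝕜)) : Type _ := ℕ+ →₀ 𝕜

instance (ν : Seminorm 𝕜 (ℕ+ →₀ 𝕜)) : SeminormedAddCommGroup (C00 ν) :=
  ν.toAddGroupSeminorm.toSeminormedAddCommGroup

instance (ν : Seminorm 𝕜 (ℕ+ →₀ 𝕜)) : Module 𝕜 (C00 ν) :=
  inferInstanceAs (Module 𝕜 (ℕ+ →₀ 𝕜))

instance (ν : Seminorm 𝕜 (ℕ+ →₀ 𝕜)) : NormedSpace 𝕜 (C00 ν) where
  norm_smul_le c x := (map_smul_eq_mul ν c x).le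

/-- The canonical basis vector `eᵢ` of `c₀₀`, as an element of the completion of `(c₀₀, ν)`. -/
def unitVector (ν : Seminorm 𝕜 (ℕ+ →₀ 𝕜)) (i : ℕ+) : UniformSpace.Completion (C00 ν) :=
  let e : C00 ν := Finsupp.single i (1 : 𝕜)
  (e : UniformSpace.Completion (C00 ν))

/-- The Schreier space `X_γ` of order `γ`: the completion of `c₀₀` in the Schreier norm. -/
abbrev SchreierSpace (𝕜 : Type*) [RCLike 𝕜] (s : Ordinal.{0} → ℕ+ → Ordinal.{0})
    (γ : Ordinal.{0}) : Type _ :=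
  UniformSpace.Completion (C00 (schreierSeminorm 𝕜 (schreierFamily s γ)))

/-- The norm `‖·‖_{G_{α,β}}` on `c₀₀` given by the sequence `f` in `X_α`. -/
abbrev gNorm (s : Ordinal.{0} → ℕ+ → Ordinal.{0}) (α β : Ordinal.{0})
    (f : ℕ+ → SchreierSpace 𝕜 s α) : Seminorm 𝕜 (ℕ+ →₀ 𝕜) :=
  intervalSeminorm (schreierFamily s β) f

/-- The space `G_{α,β}`: the completion of `c₀₀` in the norm `‖·‖_{G_{α,β}}`. -/
abbrev GSpace (s : Ordinal.{0} → ℕ+ → Ordinal.{0}) (α β : Ordinal.{0})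
    (f : ℕ+ → SchreierSpace 𝕜 s α) : Type _ :=
  UniformSpace.Completion (C00 (gNorm s α β f))

end Spaces

/-! ### Properties of bases and maps -/

/-- A sequence `e` in `Y` is boundedly complete: each series `∑ aᵢ eᵢ` with bounded partial sums
converges. -/
def IsBoundedlyComplete (𝕜 : Type*) {Y : Type*} [RCLike 𝕜] [NormedAddCommGroup Y]
    [NormedSpace 𝕜 Y] (e : ℕ+ → Y) : Prop :=
  ∀ a : ℕ+ → 𝕜, (∃ C : ℝ, ∀ n : ℕ+, ‖∑ i ∈ Finset.Icc 1 n, a i • e i‖ ≤ C) →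
    ∃ y, Tendsto (fun n : ℕ+ => ∑ i ∈ Finset.Icc 1 n, a i • e i) atTop (𝓝 y)

/-- A bounded linear map is a (metric) quotient map if it maps the open unit ball onto the open
unit ball; that is, it is onto, and the norm of the codomain is the quotient norm. -/
def IsQuotientMap (𝕜 : Type*) {Y Z : Type*} [RCLike 𝕜] [NormedAddCommGroup Y] [NormedSpace 𝕜 Y]
    [NormedAddCommGroup Z] [NormedSpace 𝕜 Z] (Q : Y →L[𝕜] Z) : Prop :=
  Q '' Metric.ball 0 1 = Metric.ball 0 1

end Lindenstrauss

end

/-! Two facts suffice: `f` is a sequence of unit vectors in a Banach space, dense in the unit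
sphere, and the family `𝒮_β` contains the singletons and is hereditary and spreading.

The supremum over intervals and the Baernstein supremum merge into one
(`IsSpreading.intervalENorm_sq`): the squared norm is the supremum, over finite lists of successive
blocks of disjoint intervals with left endpoints of each block forming a member of `𝓕`, of the sum
over the blocks of `(∑_I ‖∑_{i ∈ I} x i‖)²`. Three properties can be read off. Cutting all intervals
down to `[P, Q]` only moves left endpoints to the right, so spreading keeps the list admissible;
this makes the basis bimonotone. Lists living on successive intervals can be concatenated; this
gives a lower `2`-estimate (`IsSpreading.intervalENorm_sq_add_le`). The squared norms of partial
sums then control the squared norms of their increments, so bounded partial sums are Cauchy. A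
single interval is an admissible list; hence coordinates are bounded by the norm and `e_i ↦ f_i` is
a contraction.

Since this contraction sends the unit vectors `e_i` to a dense subset of the sphere, every `y` is
approximated by the image of some `‖y‖ e_i`, and successive approximation yields the open unit ball.
-/

namespace Lindenstrauss

/-! ### Spreading property of the Schreier families -/

/-- A family of finite sets which contains all singletons, and with each set all its subsets and
all sets obtained from these by moving elements to the right without changing their order. -/
structure IsSpreading (𝓕 : Set (Finset ℕ+)) : Prop where
  singleton_mem : ∀ n, {n} ∈ 𝓕
  mem_of_strictMonoOn : ∀ E ∈ 𝓕, ∀ (F : Finset ℕ+) (ψ : ℕ+ → ℕ+), StrictMonoOn ψ F →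
    (∀ j ∈ F, ψ j ∈ E) → (∀ j ∈ F, ψ j ≤ j) → F ∈ 𝓕

theorem IsSpreading.mono {𝓕 : Set (Finset ℕ+)} (h : IsSpreading 𝓕) {E F : Finset ℕ+}
    (hE : E ∈ 𝓕) (hF : F ⊆ E) : F ∈ 𝓕 :=
  h.mem_of_strictMonoOn E hE F id (fun _ _ _ _ hlt => hlt) (fun _ hj => hF hj) fun _ _ => le_rfl

theorem IsSpreading.empty_mem {𝓕 : Set (Finset ℕ+)} (h : IsSpreading 𝓕) : ∅ ∈ 𝓕 :=
  h.mono (h.singleton_mem 1) (Finset.empty_subset _)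

/-- Both lower bounds in the recursion, `t ≤ E_1` and `n ≤ E`, survive moving elements to the right,
so induction on membership applies. -/
theorem memSchreier_of_strictMonoOn {s : Ordinal.{0} → ℕ+ → Ordinal.{0}} {ξ : Ordinal.{0}}
    {E : Finset ℕ+} (hE : MemSchreier s ξ E) :
    ∀ (F : Finset ℕ+) (ψ : ℕ+ → ℕ+), StrictMonoOn ψ F → (∀ j ∈ F, ψ j ∈ E) →
      (∀ j ∈ F, ψ j ≤ j) → MemSchreier s ξ F := by
  induction hE with
  | empty ξ =>
    intro F ψ _ h _
    obtain rfl : F = ∅ := Finset.eq_empty_of_forall_notMem fun j hj => by simpa using h j hj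
    exact .empty ξ
  | singleton n =>
    intro F ψ hψ h _
    rcases F.eq_empty_or_nonempty with rfl | ⟨j, hj⟩
    · exact .empty 0
    · obtain rfl : F = {j} := by
        refine Finset.eq_singleton_iff_unique_mem.2 ⟨hj, fun i hi => hψ.injOn hi hj ?_⟩
        rw [Finset.mem_singleton.1 (h i hi), Finset.mem_singleton.1 (h j hj)]
      exact .singleton j
  | union ξ t F hF hne hlt ht ih =>
    intro G ψ hψ h hle
    -- Only the pieces met by `ψ` are kept, because the pieces of the new union must be non-empty.
    -- Their number is at most `t`, so the lower bound still holds.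
    let T : Finset (Fin t) := Finset.univ.filter fun j => ∃ i ∈ G, ψ i ∈ F j
    let e := T.orderEmbOfFin rfl
    let F' : Fin T.card → Finset ℕ+ := fun j => G.filter fun i => ψ i ∈ F (e j)
    have hG : G = Finset.univ.biUnion F' := by
      ext i
      simp only [F', Finset.mem_biUnion, Finset.mem_univ, true_and, Finset.mem_filter]
      refine ⟨fun hi => ?_, fun ⟨_, hi, _⟩ => hi⟩
      obtain ⟨j, -, hj⟩ := Finset.mem_biUnion.1 (h i hi)
      have hjT : j ∈ Set.range e := by
        rw [Finset.range_orderEmbOfFin]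
        simpa [T] using ⟨i, hi, hj⟩
      obtain ⟨k, rfl⟩ := hjT
      exact ⟨k, hi, hj⟩
    rw [hG]
    have hsub : ∀ j, ∀ i ∈ F' j, i ∈ G ∧ ψ i ∈ F (e j) := fun j i hi => Finset.mem_filter.1 hi
    refine .union ξ _ F' (fun j => ?_) (fun j => ?_) (fun j k hjk a ha b hb => ?_)
      fun j i hi => ?_
    · exact ih (e j) (F' j) ψ (hψ.mono fun i hi => (hsub j i hi).1) (fun i hi => (hsub j i hi).2)
        fun i hi => hle i (hsub j i hi).1
    · have := Finset.orderEmbOfFin_mem T rfl j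
      obtain ⟨i, hi, hi'⟩ := (Finset.mem_filter.1 this).2
      exact ⟨i, Finset.mem_filter.2 ⟨hi, hi'⟩⟩
    · obtain ⟨ha, ha'⟩ := hsub j a ha
      obtain ⟨hb, hb'⟩ := hsub k b hb
      exact (hψ.lt_iff_lt ha hb).1 (hlt _ _ (e.strictMono hjk) _ ha' _ hb')
    · obtain ⟨hi, hi'⟩ := hsub j i hi
      calc T.card ≤ t := (Finset.card_le_univ T).trans_eq (Fintype.card_fin t)
        _ ≤ (ψ i : ℕ) := ht _ _ hi'
        _ ≤ i := hle i hi
  | limit ξ hξ n E hn hE ih =>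
    intro F ψ hψ h hle
    exact .limit ξ hξ n F (fun i hi => (hn _ (h i hi)).trans (hle i hi)) (ih F ψ hψ h hle)

theorem memSchreier_singleton {s : Ordinal.{0} → ℕ+ → Ordinal.{0}} (hs : IsFundamentalSystem s)
    (n : ℕ+) (ξ : Ordinal.{0}) : ξ < Ordinal.omega 1 → MemSchreier s ξ {n} := by
  induction ξ using Ordinal.limitRecOn with
  | zero => exact fun _ => .singleton n
  | add_one ξ ih =>
    intro hξ
    have := MemSchreier.union ξ 1 (fun _ => {n})
      (fun _ => ih ((Order.lt_succ ξ).trans hξ)) (fun _ => Finset.singleton_nonempty n)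
      (fun j k hjk => absurd hjk (by simp [Subsingleton.elim j k])) (fun _ i _ => i.pos)
    simpa using this
  | limit ξ hξ ih =>
    intro h
    have hlt := (hs ξ h hξ).2.1 1
    exact .limit ξ hξ 1 {n} (fun i _ => one_le) (ih _ hlt (hlt.trans h))

theorem isSpreading_schreierFamily {s : Ordinal.{0} → ℕ+ → Ordinal.{0}}
    (hs : IsFundamentalSystem s) {ξ : Ordinal.{0}} (hξ : ξ < Ordinal.omega 1) :
    IsSpreading (schreierFamily s ξ) where
  singleton_mem n := memSchreier_singleton hs n ξ hξ
  mem_of_strictMonoOn _ hE := memSchreier_of_strictMonoOn hE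

/-! ### The squared norm as a supremum over blocks of intervals -/

section IntervalNorm

variable {E : Type*} [NormedAddCommGroup E] {𝓕 : Set (Finset ℕ+)}

/-- A finite set of pairwise disjoint intervals, encoded by their endpoints, whose left endpoints
form a member of `𝓕`. -/
structure IsBlock (𝓕 : Set (Finset ℕ+)) (K : Finset (ℕ+ × ℕ+)) : Prop where
  le : ∀ I ∈ K, I.1 ≤ I.2
  disjoint : ∀ I ∈ K, ∀ J ∈ K, I ≠ J → I.2 < J.1 ∨ J.2 < I.1
  mem : K.image Prod.fst ∈ 𝓕

/-- A list of successive blocks of intervals. -/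
structure IsAdmissible (𝓕 : Set (Finset ℕ+)) (L : List (Finset (ℕ+ × ℕ+))) : Prop where
  isBlock : ∀ K ∈ L, IsBlock 𝓕 K
  pairwise : L.Pairwise fun K K' => ∀ I ∈ K, ∀ J ∈ K', I.2 < J.1

/-- The sum of the norms of the interval sums of `x` over a block. -/
noncomputable def blockSum (x : ℕ+ → E) (K : Finset (ℕ+ × ℕ+)) : ℝ≥0∞ :=
  ∑ I ∈ K, ‖∑ i ∈ Finset.Icc I.1 I.2, x i‖ₑ

/-- The sum of the squared block sums of `x` over a list of blocks. -/
noncomputable def admissibleSum (x : ℕ+ → E) (L : List (Finset (ℕ+ × ℕ+))) : ℝ≥0∞ :=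
  (L.map fun K => blockSum x K ^ 2).sum

theorem rpow_half_sq (a : ℝ≥0∞) : (a ^ (1 / 2 : ℝ)) ^ 2 = a := by
  rw [← ENNReal.rpow_two, ← ENNReal.rpow_mul]
  norm_num

theorem IsSuccessive.before {A : ℕ → Finset ℕ+} (h : IsSuccessive A) {m n : ℕ} (hmn : m < n) :
    Before (A m) (A n) := by
  induction n, hmn using Nat.le_induction with
  | base => exact h.2 m
  | succ n _ ih =>
    intro a ha b hb
    obtain ⟨c, hc⟩ := h.1 n
    exact (ih a ha c hc).trans (h.2 n c hc b hb)

theorem list_sum_map_filter {α : Type*} (L : List α) (P : α → Prop) [DecidablePred P]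
    (g : α → ℝ≥0∞) (h : ∀ a, ¬ P a → g a = 0) : ((L.filter P).map g).sum = (L.map g).sum := by
  induction L with
  | nil => rfl
  | cons a L ih =>
    by_cases ha : P a
    · simp [ha, ih]
    · simp [ha, ih, h a ha]

/-- Bridges finite lists, possibly with empty members, and the infinite sequences of non-empty sets
in the Baernstein norm: empty sets contribute nothing, and singletons far to the right complete the
sequence. -/
theorem list_sum_schreierENorm_sq_le (𝓕 : Set (Finset ℕ+)) (u : ℕ+ → E)
    (L : List (Finset ℕ+)) (hL : L.Pairwise Before) :
    (L.map fun A : Finset ℕ+ => schreierENorm 𝓕 (Set.indicator (A : Set ℕ+) u) ^ 2).sum ≤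
      baernsteinENorm 𝓕 u ^ 2 := by
  wlog hne : ∀ A ∈ L, A.Nonempty generalizing L
  · refine le_trans (le_of_eq ?_) (this (L.filter fun A => A.Nonempty) (hL.filter _)
      fun A hA => by simpa using (List.mem_filter.1 hA).2)
    refine (list_sum_map_filter L _ _ fun A hA => ?_).symm
    rw [Finset.not_nonempty_iff_eq_empty.1 hA]
    simp [schreierENorm]
  obtain ⟨W, hW⟩ : ∃ W : ℕ+, ∀ A ∈ L, ∀ i ∈ A, i < W := by
    obtain ⟨W, hW⟩ := (L.toFinset.biUnion id).bddAbove
    refine ⟨W + 1, fun A hA i hi => PNat.lt_add_one_iff.2 (hW ?_)⟩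
    simpa using ⟨A, hA, hi⟩
  -- The tail consists of singletons beyond `W`, which bounds all sets of the list.
  let A : ℕ → Finset ℕ+ := fun n =>
    if h : n < L.length then L[n] else {W + n.succPNat}
  have hA : IsSuccessive A := by
    refine ⟨fun n => ?_, fun n i hi j hj => ?_⟩
    · by_cases h : n < L.length
      · simpa [A, h] using hne _ (List.getElem_mem h)
      · simp [A, h]
    · by_cases h' : n + 1 < L.length
      · have h : n < L.length := by omega
        simp only [A, h, h', dif_pos] at hi hj
        exact List.pairwise_iff_getElem.1 hL n (n + 1) h h' (by omega) i hi j hj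
      · simp only [A, h', dif_neg, not_false_eq_true, Finset.mem_singleton] at hj
        subst hj
        by_cases h : n < L.length
        · simp only [A, h, dif_pos] at hi
          exact (hW _ (List.getElem_mem h) i hi).trans (PNat.lt_add_right _ _)
        · simp only [A, h, dif_neg, not_false_eq_true, Finset.mem_singleton] at hi
          subst hi
          exact add_lt_add_right (Nat.succPNat_lt_succPNat.2 n.lt_succ_self) W
  have key := le_baernsteinENorm 𝓕 u hA
  calc _ = ∑ n ∈ Finset.range L.length,
          schreierENorm 𝓕 (Set.indicator (A n : Set ℕ+) u) ^ 2 := by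
        rw [Finset.sum_range, ← Fin.sum_univ_fun_getElem]
        refine Finset.sum_congr rfl fun n _ => ?_
        simp [A]
    _ ≤ ∑' n, schreierENorm 𝓕 (Set.indicator (A n : Set ℕ+) u) ^ 2 := ENNReal.sum_le_tsum _
    _ = ((∑' n, schreierENorm 𝓕 (Set.indicator (A n : Set ℕ+) u) ^ 2) ^ (1 / 2 : ℝ)) ^ 2 :=
        (rpow_half_sq _).symm
    _ ≤ _ := by gcongr

/-- Disjoint intervals are ordered by their left endpoints, which also determine them; enumerating
these and appending one-point intervals beyond `W` gives the sequence. -/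
theorem exists_isIntervalSeq (M : Finset (ℕ+ × ℕ+)) (hle : ∀ I ∈ M, I.1 ≤ I.2)
    (hM : ∀ I ∈ M, ∀ J ∈ M, I ≠ J → I.2 < J.1 ∨ J.2 < I.1) :
    ∃ p q, IsIntervalSeq p q ∧ ∀ I ∈ M, ∃ n, p n = I.1 ∧ q n = I.2 := by
  obtain ⟨W, hW⟩ : ∃ W : ℕ+, ∀ I ∈ M, I.2 < W := by
    obtain ⟨W, hW⟩ := (M.image Prod.snd).bddAbove
    exact ⟨W + 1, fun I hI => PNat.lt_add_one_iff.2 (hW (by simpa using ⟨I.1, hI⟩))⟩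
  have hex : ∀ i, ∃ r, i ∈ M.image Prod.fst → (i, r) ∈ M := by
    intro i
    by_cases hi : i ∈ M.image Prod.fst
    · obtain ⟨I, hI, rfl⟩ := Finset.mem_image.1 hi
      exact ⟨I.2, fun _ => hI⟩
    · exact ⟨1, fun h => absurd h hi⟩
  choose r hr using hex
  let e := (M.image Prod.fst).orderEmbOfFin rfl
  have he : ∀ k, (e k, r (e k)) ∈ M := fun k => hr _ (Finset.orderEmbOfFin_mem _ rfl k)
  let p : ℕ → ℕ+ := fun n =>
    if h : n < (M.image Prod.fst).card then e ⟨n, h⟩ else W + n.succPNat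
  let q : ℕ → ℕ+ := fun n =>
    if h : n < (M.image Prod.fst).card then r (e ⟨n, h⟩) else W + n.succPNat
  refine ⟨p, q, ⟨fun n => ?_, fun n => ?_⟩, fun I hI => ?_⟩
  · by_cases h : n < (M.image Prod.fst).card
    · simpa only [p, q, h, dif_pos] using hle _ (he ⟨n, h⟩)
    · simp [p, q, h]
  · by_cases h' : n + 1 < (M.image Prod.fst).card
    · have h : n < (M.image Prod.fst).card := by omega
      simp only [p, q, h, h', dif_pos]
      have hlt : e ⟨n, h⟩ < e ⟨n + 1, h'⟩ := e.strictMono (by simp [Fin.lt_def])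
      rcases hM _ (he ⟨n, h⟩) _ (he ⟨n + 1, h'⟩) (fun h => hlt.ne (congrArg Prod.fst h))
        with h1 | h1
      · exact h1
      · exact absurd (h1.trans hlt) (not_lt.2 (hle _ (he _)))
    · by_cases h : n < (M.image Prod.fst).card
      · simp only [p, q, h, h', dif_pos, dif_neg, not_false_eq_true]
        exact (hW _ (he ⟨n, h⟩)).trans (PNat.lt_add_right _ _)
      · simp only [p, q, h, h', dif_neg, not_false_eq_true]
        exact add_lt_add_right (Nat.succPNat_lt_succPNat.2 n.lt_succ_self) W
  · have hI' : I.1 ∈ Set.range e := by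
      rw [Finset.range_orderEmbOfFin]
      exact Finset.mem_coe.2 (Finset.mem_image_of_mem _ hI)
    obtain ⟨k, hk⟩ := hI'
    refine ⟨k, by simp [p, hk], ?_⟩
    simp only [q, k.2, dif_pos, Fin.eta, hk]
    by_contra hne
    have hmem : (I.1, r I.1) ∈ M := hk ▸ he k
    rcases hM _ hmem _ hI (fun h => hne (congrArg Prod.snd h)) with h1 | h1
    · exact absurd h1 (not_lt.2 (hle _ hmem))
    · exact absurd h1 (not_lt.2 (hle _ hI))

theorem IsBlock.injOn_fst {K : Finset (ℕ+ × ℕ+)} (hK : IsBlock 𝓕 K) :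
    Set.InjOn Prod.fst (K : Set (ℕ+ × ℕ+)) := by
  intro I hI J hJ h
  by_contra hne
  rcases hK.disjoint I hI J hJ hne with h1 | h1
  · exact absurd h1 (not_lt.2 (h ▸ hK.le I hI))
  · exact absurd h1 (not_lt.2 (h ▸ hK.le J hJ))

theorem IsAdmissible.admissibleSum_le {L : List (Finset (ℕ+ × ℕ+))} (hL : IsAdmissible 𝓕 L)
    (x : ℕ+ → E) : admissibleSum x L ≤ intervalENorm 𝓕 x ^ 2 := by
  let M : Finset (ℕ+ × ℕ+) := L.toFinset.biUnion id
  have hmem : ∀ I, I ∈ M ↔ ∃ K ∈ L, I ∈ K := fun I => by simp [M]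
  obtain ⟨p, q, hpq, hM⟩ := exists_isIntervalSeq M
    (fun I hI => by
      obtain ⟨K, hK, hI⟩ := (hmem I).1 hI
      exact (hL.isBlock K hK).le I hI)
    (fun I hI J hJ hne => by
      obtain ⟨K, hK, hI⟩ := (hmem I).1 hI
      obtain ⟨K', hK', hJ⟩ := (hmem J).1 hJ
      by_cases h : K = K'
      · subst h
        exact (hL.isBlock K hK).disjoint I hI J hJ hne
      -- Which of the two blocks comes first in the list is unknown, hence the symmetrized relation.
      · let R : Finset (ℕ+ × ℕ+) → Finset (ℕ+ × ℕ+) → Prop := fun K K' =>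
          (∀ I ∈ K, ∀ J ∈ K', I.2 < J.1) ∨ ∀ I ∈ K', ∀ J ∈ K, I.2 < J.1
        have hR : Std.Symm R := ⟨fun _ _ => Or.symm⟩
        have hpw : L.Pairwise R := hL.pairwise.imp Or.inl
        have := hpw.forall hK hK' h
        exact this.imp (fun h => h I hI J hJ) fun h => h J hJ I hI)
  have hblock : ∀ K ∈ L, blockSum x K ≤ schreierENorm 𝓕
      (Set.indicator ((K.image Prod.fst : Finset ℕ+) : Set ℕ+) (blockVector p q x)) := by
    intro K hK
    refine le_trans (le_of_eq ?_) (le_iSup₂ (f := fun (A : Finset ℕ+) (_ : A ∈ 𝓕) =>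
      ∑ i ∈ A, ‖Set.indicator ((K.image Prod.fst : Finset ℕ+) : Set ℕ+) (blockVector p q x) i‖ₑ)
      (K.image Prod.fst) (hL.isBlock K hK).mem)
    rw [Finset.sum_image (hL.isBlock K hK).injOn_fst, blockSum]
    refine Finset.sum_congr rfl fun I hI => ?_
    rw [Set.indicator_of_mem (Finset.mem_coe.2 (Finset.mem_image_of_mem _ hI))]
    obtain ⟨n, hp, hq⟩ := hM I ((hmem I).2 ⟨K, hK, hI⟩)
    rw [← hp, ← hq, blockVector_apply hpq, enorm_norm]
  have hpw : (L.map (Finset.image Prod.fst)).Pairwise Before := by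
    refine List.pairwise_map.2 (hL.pairwise.imp_of_mem fun {K K'} hK _ h i hi j hj => ?_)
    obtain ⟨I, hI, rfl⟩ := Finset.mem_image.1 hi
    obtain ⟨J, hJ, rfl⟩ := Finset.mem_image.1 hj
    exact ((hL.isBlock K hK).le I hI).trans_lt (h I hI J hJ)
  calc admissibleSum x L ≤ ((L.map (Finset.image Prod.fst)).map fun A : Finset ℕ+ =>
        schreierENorm 𝓕 (Set.indicator (A : Set ℕ+) (blockVector p q x)) ^ 2).sum := by
        rw [List.map_map]
        refine List.sum_le_sum fun K hK => ?_
        have := hblock K hK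
        simp only [Function.comp_apply]
        gcongr
    _ ≤ baernsteinENorm 𝓕 (blockVector p q x) ^ 2 := list_sum_schreierENorm_sq_le 𝓕 _ _ hpw
    _ ≤ _ := by
        gcongr
        exact le_intervalENorm 𝓕 x hpq

/-- On a finite set only finitely many traces of members of `𝓕` matter, and these are again in `𝓕`,
so the supremum is attained. -/
theorem IsSpreading.exists_schreierENorm_eq (h : IsSpreading 𝓕) (A : Finset ℕ+) (u : ℕ+ → E) :
    ∃ F ∈ 𝓕, F ⊆ A ∧ schreierENorm 𝓕 (Set.indicator (A : Set ℕ+) u) = ∑ i ∈ F, ‖u i‖ₑ := by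
  classical
  obtain ⟨F, hF, hmax⟩ := (A.powerset.filter fun F => F ∈ 𝓕).exists_max_image
    (fun F => ∑ i ∈ F, ‖u i‖ₑ) ⟨∅, by simp [h.empty_mem]⟩
  simp only [Finset.mem_filter, Finset.mem_powerset] at hF hmax
  refine ⟨F, hF.2, hF.1, le_antisymm (iSup₂_le fun B hB => ?_) ?_⟩
  · refine le_trans (le_of_eq ?_) (hmax (B.filter fun i => i ∈ A)
      ⟨fun i hi => (Finset.mem_filter.1 hi).2, h.mono hB (Finset.filter_subset _ _)⟩)
    rw [Finset.sum_filter]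
    refine Finset.sum_congr rfl fun i _ => ?_
    by_cases hi : i ∈ A <;> simp [hi]
  · refine le_trans (le_of_eq ?_) (le_iSup₂ (f := fun (B : Finset ℕ+) (_ : B ∈ 𝓕) =>
      ∑ i ∈ B, ‖Set.indicator (A : Set ℕ+) u i‖ₑ) F hF.2)
    refine Finset.sum_congr rfl fun i hi => ?_
    rw [Set.indicator_of_mem (Finset.mem_coe.2 (hF.1 hi))]

theorem IsSpreading.exists_isBlock (h : IsSpreading 𝓕) {p q : ℕ → ℕ+} (hpq : IsIntervalSeq p q)
    (x : ℕ+ → E) (A : Finset ℕ+) :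
    ∃ K, IsBlock 𝓕 K ∧ (∀ I ∈ K, I.1 ∈ A ∧ ∃ n, I = (p n, q n)) ∧
      schreierENorm 𝓕 (Set.indicator (A : Set ℕ+) (blockVector p q x)) = blockSum x K := by
  classical
  obtain ⟨F, hF, hFA, hsum⟩ := h.exists_schreierENorm_eq A (blockVector p q x)
  -- The block vector vanishes away from the left endpoints `p n`, so the other elements of `F` can
  -- be dropped.
  let F' : Finset ℕ+ := F.filter fun i => ∃ n, p n = i
  let g : ℕ+ → ℕ+ × ℕ+ := fun i => (i, q (Function.invFun p i))
  have hg : ∀ n, g (p n) = (p n, q n) := fun n => by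
    simp [g, Function.leftInverse_invFun hpq.injective n]
  have hginj : Set.InjOn g (F' : Set ℕ+) := fun i _ j _ hij => congrArg Prod.fst hij
  have hmem : ∀ I ∈ F'.image g, I.1 ∈ F ∧ ∃ n, I = (p n, q n) := by
    intro I hI
    obtain ⟨i, hi, rfl⟩ := Finset.mem_image.1 hI
    obtain ⟨hi, n, rfl⟩ := Finset.mem_filter.1 hi
    exact ⟨hi, n, hg n⟩
  have hsep : ∀ m n, m < n → q m < p n := fun m n hmn =>
    hpq.isSuccessive.before hmn _ (Finset.right_mem_Icc.2 (hpq.1 m)) _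
      (Finset.left_mem_Icc.2 (hpq.1 n))
  refine ⟨F'.image g, ⟨fun I hI => ?_, fun I hI J hJ hne => ?_, ?_⟩,
    fun I hI => ⟨hFA (hmem I hI).1, (hmem I hI).2⟩, ?_⟩
  · obtain ⟨-, n, rfl⟩ := hmem I hI
    exact hpq.1 n
  · obtain ⟨-, m, rfl⟩ := hmem I hI
    obtain ⟨-, n, rfl⟩ := hmem J hJ
    have hmn : m ≠ n := by rintro rfl; exact hne rfl
    exact hmn.lt_or_gt.imp (hsep m n) (hsep n m)
  · refine h.mono hF fun i hi => ?_
    obtain ⟨I, hI, rfl⟩ := Finset.mem_image.1 hi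
    exact (hmem I hI).1
  · rw [hsum, blockSum, Finset.sum_image hginj, Finset.sum_filter]
    refine Finset.sum_congr rfl fun i _ => ?_
    split_ifs with hi
    · obtain ⟨n, rfl⟩ := hi
      rw [hg, blockVector_apply hpq, enorm_norm]
    · rw [blockVector_apply_of_notMem x hi, enorm_zero]

/-- In this form the intervals are no longer fixed before the sets `A n` are chosen, so a
configuration can be truncated or extended directly. -/
theorem IsSpreading.intervalENorm_sq (h : IsSpreading 𝓕) (x : ℕ+ → E) :
    intervalENorm 𝓕 x ^ 2 = ⨆ (L) (_ : IsAdmissible 𝓕 L), admissibleSum x L := by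
  refine le_antisymm ?_ (iSup₂_le fun L hL => hL.admissibleSum_le x)
  set C := ⨆ (L) (_ : IsAdmissible 𝓕 L), admissibleSum x L with hC
  suffices intervalENorm 𝓕 x ≤ C ^ (1 / 2 : ℝ) by
    rw [← rpow_half_sq C]
    gcongr
  refine intervalENorm_le fun p q hpq => iSup₂_le fun A hA => ?_
  gcongr
  refine ENNReal.tsum_le_of_sum_range_le fun N => ?_
  choose K hK hKA hsum using fun n => h.exists_isBlock hpq x (A n)
  have hadm : IsAdmissible 𝓕 ((List.range N).map K) := by
    refine ⟨fun B hB => ?_, List.pairwise_map.2 (List.pairwise_lt_range.imp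
      fun {m n} hmn I hI J hJ => ?_)⟩
    · obtain ⟨n, -, rfl⟩ := List.mem_map.1 hB
      exact hK n
    · obtain ⟨hIA, a, rfl⟩ := hKA m I hI
      obtain ⟨hJA, b, rfl⟩ := hKA n J hJ
      -- The sets `A n` separate only the left endpoints; as the intervals are successive, this
      -- separates the whole intervals.
      have hlt : p a < p b := hA.before hmn _ hIA _ hJA
      have hab : a < b := (strictMono_nat_of_lt_succ fun n =>
        (hpq.1 n).trans_lt (hpq.2 n)).lt_iff_lt.1 hlt
      exact hpq.isSuccessive.before hab _ (Finset.right_mem_Icc.2 (hpq.1 a)) _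
        (Finset.left_mem_Icc.2 (hpq.1 b))
  refine le_trans (le_of_eq ?_) (le_iSup₂ (f := fun L (_ : IsAdmissible 𝓕 L) =>
    admissibleSum x L) _ hadm)
  simp only [hsum, admissibleSum, List.map_map, Function.comp_def]
  rfl

/-! ### Restriction to intervals and the lower `2`-estimate -/

/-- The intersections of the intervals of `K` with `[P, Q]`. -/
def restrictBlock (P Q : ℕ+) (K : Finset (ℕ+ × ℕ+)) : Finset (ℕ+ × ℕ+) :=
  (K.filter fun I => max I.1 P ≤ min I.2 Q).image fun I => (max I.1 P, min I.2 Q)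

theorem mem_restrictBlock {P Q : ℕ+} {K : Finset (ℕ+ × ℕ+)} {J : ℕ+ × ℕ+} :
    J ∈ restrictBlock P Q K ↔
      ∃ I ∈ K, max I.1 P ≤ min I.2 Q ∧ (max I.1 P, min I.2 Q) = J := by
  simp only [restrictBlock, Finset.mem_image, Finset.mem_filter, and_assoc]

theorem IsSpreading.isBlock_restrictBlock (h : IsSpreading 𝓕) {K : Finset (ℕ+ × ℕ+)}
    (hK : IsBlock 𝓕 K) (P Q : ℕ+) : IsBlock 𝓕 (restrictBlock P Q K) := by
  refine ⟨fun J hJ => ?_, fun J hJ J' hJ' hne => ?_, ?_⟩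
  · obtain ⟨I, -, hI, rfl⟩ := mem_restrictBlock.1 hJ
    exact hI
  · obtain ⟨I, hI, -, rfl⟩ := mem_restrictBlock.1 hJ
    obtain ⟨I', hI', -, rfl⟩ := mem_restrictBlock.1 hJ'
    have : I ≠ I' := by rintro rfl; exact hne rfl
    exact (hK.disjoint I hI I' hI' this).imp
      (fun h => (min_le_left _ _).trans_lt (h.trans_le (le_max_left _ _)))
      fun h => (min_le_left _ _).trans_lt (h.trans_le (le_max_left _ _))
  · have hex : ∀ j, ∃ i, j ∈ (restrictBlock P Q K).image Prod.fst →
        i ∈ K.image Prod.fst ∧ max i P = j := by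
      intro j
      by_cases hj : j ∈ (restrictBlock P Q K).image Prod.fst
      · obtain ⟨J, hJ, rfl⟩ := Finset.mem_image.1 hj
        obtain ⟨I, hI, -, rfl⟩ := mem_restrictBlock.1 hJ
        exact ⟨I.1, fun _ => ⟨Finset.mem_image_of_mem _ hI, rfl⟩⟩
      · exact ⟨1, fun h => absurd h hj⟩
    -- `ψ` returns a new left endpoint `max i P` to an old one `i`. It is strictly increasing
    -- because `i ↦ max i P` is monotone, and it moves points to the left, so spreading applies.
    choose ψ hψ using hex
    refine h.mem_of_strictMonoOn _ hK.mem _ ψ (fun i hi j hj hij => ?_) (fun j hj => (hψ j hj).1)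
      fun j hj => (le_max_left _ P).trans_eq (hψ j hj).2
    by_contra hle
    rw [← (hψ i hi).2, ← (hψ j hj).2] at hij
    exact absurd hij (not_lt.2 (max_le_max_right P (not_lt.1 hle)))

theorem IsSpreading.isAdmissible_restrictBlock (h : IsSpreading 𝓕)
    {L : List (Finset (ℕ+ × ℕ+))} (hL : IsAdmissible 𝓕 L) (P Q : ℕ+) :
    IsAdmissible 𝓕 (L.map (restrictBlock P Q)) := by
  refine ⟨fun K hK => ?_, List.pairwise_map.2 (hL.pairwise.imp fun {K K'} hKK' I hI J hJ => ?_)⟩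
  · obtain ⟨K', hK', rfl⟩ := List.mem_map.1 hK
    exact h.isBlock_restrictBlock (hL.isBlock K' hK') P Q
  · obtain ⟨I', hI', -, rfl⟩ := mem_restrictBlock.1 hI
    obtain ⟨J', hJ', -, rfl⟩ := mem_restrictBlock.1 hJ
    exact (min_le_left _ _).trans_lt ((hKK' I' hI' J' hJ').trans_le (le_max_left _ _))

theorem IsBlock.blockSum_indicator {K : Finset (ℕ+ × ℕ+)} (hK : IsBlock 𝓕 K) (P Q : ℕ+)
    (x : ℕ+ → E) :
    blockSum (Set.indicator (Set.Icc P Q) x) K = blockSum x (restrictBlock P Q K) := by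
  -- Disjoint intervals have distinct traces when these are non-empty; the empty traces contribute
  -- zero.
  have hinj : Set.InjOn (fun I : ℕ+ × ℕ+ => (max I.1 P, min I.2 Q))
      (K.filter fun I => max I.1 P ≤ min I.2 Q : Finset (ℕ+ × ℕ+)) := by
    intro I hI J hJ hIJ
    obtain ⟨hI, hI'⟩ := Finset.mem_filter.1 hI
    obtain ⟨hJ, hJ'⟩ := Finset.mem_filter.1 hJ
    simp only [Prod.mk.injEq] at hIJ
    by_contra hne
    rcases hK.disjoint I hI J hJ hne with h1 | h1
    · exact absurd (((le_max_left J.1 P).trans (hIJ.1 ▸ hI')).trans (min_le_left _ _))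
        (not_le.2 h1)
    · exact absurd (((le_max_left I.1 P).trans (hIJ.1 ▸ hJ')).trans (min_le_left _ _))
        (not_le.2 h1)
  rw [blockSum, blockSum, restrictBlock, Finset.sum_image hinj, Finset.sum_filter]
  refine Finset.sum_congr rfl fun I _ => ?_
  have hsum : ∑ i ∈ Finset.Icc I.1 I.2, Set.indicator (Set.Icc P Q) x i =
      ∑ i ∈ Finset.Icc (max I.1 P) (min I.2 Q), x i := by
    rw [Finset.sum_indicator_eq_sum_filter]
    refine Finset.sum_congr ?_ fun _ _ => rfl
    ext i
    simp only [Finset.mem_filter, Finset.mem_Icc, Set.mem_Icc, max_le_iff, le_min_iff]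
    tauto
  rw [hsum]
  split_ifs with hI
  · rfl
  · rw [Finset.Icc_eq_empty hI, Finset.sum_empty, enorm_zero]

theorem IsAdmissible.admissibleSum_indicator {L : List (Finset (ℕ+ × ℕ+))}
    (hL : IsAdmissible 𝓕 L) (P Q : ℕ+) (x : ℕ+ → E) :
    admissibleSum (Set.indicator (Set.Icc P Q) x) L =
      admissibleSum x (L.map (restrictBlock P Q)) := by
  rw [admissibleSum, admissibleSum, List.map_map]
  congr 1
  refine List.map_congr_left fun K hK => ?_
  rw [(hL.isBlock K hK).blockSum_indicator, Function.comp_apply]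

theorem IsSpreading.intervalENorm_indicator_le (h : IsSpreading 𝓕) (x : ℕ+ → E) (P Q : ℕ+) :
    intervalENorm 𝓕 (Set.indicator (Set.Icc P Q) x) ≤ intervalENorm 𝓕 x := by
  refine (ENNReal.pow_le_pow_left_iff two_ne_zero).1 ?_
  rw [h.intervalENorm_sq (Set.indicator _ _)]
  refine iSup₂_le fun L hL => ?_
  rw [hL.admissibleSum_indicator]
  exact (h.isAdmissible_restrictBlock hL P Q).admissibleSum_le x

/-- The norm satisfies a lower `2`-estimate on successive intervals. -/
theorem IsSpreading.intervalENorm_sq_add_le (h : IsSpreading 𝓕) (x : ℕ+ → E) {P Q P' Q' : ℕ+}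
    (hQ : Q < P') :
    intervalENorm 𝓕 (Set.indicator (Set.Icc P Q) x) ^ 2 +
      intervalENorm 𝓕 (Set.indicator (Set.Icc P' Q') x) ^ 2 ≤ intervalENorm 𝓕 x ^ 2 := by
  rw [h.intervalENorm_sq (Set.indicator (Set.Icc P Q) x),
    h.intervalENorm_sq (Set.indicator (Set.Icc P' Q') x)]
  have hnil : IsAdmissible 𝓕 [] := ⟨by simp, by simp⟩
  refine ENNReal.biSup_add_biSup_le' ⟨[], hnil⟩ ⟨[], hnil⟩ fun L hL L' hL' => ?_
  rw [hL.admissibleSum_indicator, hL'.admissibleSum_indicator]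
  have h1 := h.isAdmissible_restrictBlock hL P Q
  have h2 := h.isAdmissible_restrictBlock hL' P' Q'
  -- After restriction the two lists live on `[P, Q]` and `[P', Q']` with `Q < P'`, so their
  -- concatenation is admissible.
  have hadm : IsAdmissible 𝓕 (L.map (restrictBlock P Q) ++ L'.map (restrictBlock P' Q')) := by
    refine ⟨fun K hK => (List.mem_append.1 hK).elim (h1.isBlock K) (h2.isBlock K),
      List.pairwise_append.2 ⟨h1.pairwise, h2.pairwise, fun K hK K' hK' I hI J hJ => ?_⟩⟩
    obtain ⟨K, -, rfl⟩ := List.mem_map.1 hK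
    obtain ⟨K', -, rfl⟩ := List.mem_map.1 hK'
    obtain ⟨I, -, -, rfl⟩ := mem_restrictBlock.1 hI
    obtain ⟨J, -, -, rfl⟩ := mem_restrictBlock.1 hJ
    exact (min_le_right _ _).trans_lt (hQ.trans_le (le_max_right _ _))
  refine le_trans (le_of_eq ?_) (hadm.admissibleSum_le x)
  simp [admissibleSum]

theorem IsSpreading.enorm_sum_le_intervalENorm (h : IsSpreading 𝓕) (x : ℕ+ → E) {P Q : ℕ+}
    (hPQ : P ≤ Q) : ‖∑ i ∈ Finset.Icc P Q, x i‖ₑ ≤ intervalENorm 𝓕 x := by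
  refine (ENNReal.pow_le_pow_left_iff two_ne_zero).1 ?_
  have hadm : IsAdmissible 𝓕 [{(P, Q)}] := by
    refine ⟨fun K hK => ?_, by simp⟩
    obtain rfl := List.mem_singleton.1 hK
    exact ⟨by simpa using hPQ, by simp, by simpa using h.singleton_mem P⟩
  refine le_trans (le_of_eq ?_) (hadm.admissibleSum_le x)
  simp [admissibleSum, blockSum]

end IntervalNorm

/-! ### The completion and its Schauder basis -/

section IntervalSpace

open UniformSpace (Completion)

variable {𝕜 : Type*} [RCLike 𝕜]

/-- The canonical map of `c₀₀` into its completion with respect to a seminorm. -/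
noncomputable def toCompletion (ν : Seminorm 𝕜 (ℕ+ →₀ 𝕜)) :
    (ℕ+ →₀ 𝕜) →ₗ[𝕜] Completion (C00 ν) :=
  (Completion.toComplₗᵢ (𝕜 := 𝕜) (E := C00 ν)).toLinearMap

theorem denseRange_toCompletion (ν : Seminorm 𝕜 (ℕ+ →₀ 𝕜)) : DenseRange (toCompletion ν) :=
  Completion.denseRange_coe (α := C00 ν)

theorem norm_toCompletion (ν : Seminorm 𝕜 (ℕ+ →₀ 𝕜)) (a : ℕ+ →₀ 𝕜) :
    ‖toCompletion ν a‖ = ν a :=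
  Completion.norm_coe (E := C00 ν) a

theorem toCompletion_single_one (ν : Seminorm 𝕜 (ℕ+ →₀ 𝕜)) (i : ℕ+) :
    toCompletion ν (Finsupp.single i 1) = unitVector ν i :=
  rfl

theorem toCompletion_sum_single (ν : Seminorm 𝕜 (ℕ+ →₀ 𝕜)) (a : ℕ+ → 𝕜) (s : Finset ℕ+) :
    toCompletion ν (∑ i ∈ s, Finsupp.single i (a i)) = ∑ i ∈ s, a i • unitVector ν i := by
  rw [map_sum]
  refine Finset.sum_congr rfl fun i _ => ?_
  rw [← toCompletion_single_one, ← map_smul, Finsupp.smul_single_one]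

theorem exists_sum_Icc_single_eq (a : ℕ+ →₀ 𝕜) :
    ∃ N : ℕ+, ∀ n ≥ N, ∑ i ∈ Finset.Icc 1 n, Finsupp.single i (a i) = a := by
  obtain ⟨N, hN⟩ := a.support.bddAbove
  refine ⟨N, fun n hn => ?_⟩
  have hsub : a.support ⊆ Finset.Icc 1 n := fun i hi =>
    Finset.mem_Icc.2 ⟨one_le, (hN hi).trans hn⟩
  conv_rhs => rw [← a.sum_single]
  exact (Finsupp.sum_of_support_subset a hsub _ fun i _ => Finsupp.single_zero i).symm

section Extension

variable {F : Type*} [NormedAddCommGroup F] [NormedSpace 𝕜 F] [CompleteSpace F]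

/-- The extension to the completion of a linear map on `c₀₀` which is bounded with respect to the
seminorm. -/
noncomputable def extendCompletion (ν : Seminorm 𝕜 (ℕ+ →₀ 𝕜)) (T : (ℕ+ →₀ 𝕜) →ₗ[𝕜] F) :
    Completion (C00 ν) →L[𝕜] F :=
  T.extendOfNorm (toCompletion ν)

variable {ν : Seminorm 𝕜 (ℕ+ →₀ 𝕜)} {T : (ℕ+ →₀ 𝕜) →ₗ[𝕜] F}

theorem extendCompletion_toCompletion (hT : ∀ a, ‖T a‖ ≤ ‖toCompletion ν a‖) (a : ℕ+ →₀ 𝕜) :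
    extendCompletion ν T (toCompletion ν a) = T a :=
  LinearMap.extendOfNorm_eq (denseRange_toCompletion ν)
    ⟨1, fun a => (hT a).trans_eq (one_mul _).symm⟩ a

theorem norm_extendCompletion_apply_le (hT : ∀ a, ‖T a‖ ≤ ‖toCompletion ν a‖)
    (g : Completion (C00 ν)) : ‖extendCompletion ν T g‖ ≤ ‖g‖ :=
  (LinearMap.norm_extendOfNorm_apply_le (denseRange_toCompletion ν) 1
    (fun a => (hT a).trans_eq (one_mul _).symm) g).trans_eq (one_mul _)

end Extension

variable {X : Type*} [NormedAddCommGroup X] [NormedSpace 𝕜 X] {𝓕 : Set (Finset ℕ+)} {f : ℕ+ → X}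

theorem enorm_toCompletion (a : ℕ+ →₀ 𝕜) :
    ‖toCompletion (intervalSeminorm (𝕜 := 𝕜) 𝓕 f) a‖ₑ = intervalENorm 𝓕 fun i => a i • f i := by
  rw [← ofReal_norm, norm_toCompletion]
  exact ENNReal.ofReal_toReal
    ((intervalENorm_le_tsum _ _).trans_lt (tsum_enorm_smul_lt_top f a)).ne

theorem enorm_sum_Icc_unitVector (a : ℕ+ → 𝕜) (p q : ℕ+) :
    ‖∑ i ∈ Finset.Icc p q, a i • unitVector (intervalSeminorm (𝕜 := 𝕜) 𝓕 f) i‖ₑ =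
      intervalENorm 𝓕 (Set.indicator (Set.Icc p q) fun i => a i • f i) := by
  rw [← toCompletion_sum_single, enorm_toCompletion]
  congr 1
  ext i
  rw [Finsupp.finsetSum_apply]
  simp only [Finsupp.single_apply, Finset.sum_ite_eq', Finset.mem_Icc]
  by_cases hi : i ∈ Set.Icc p q
  · rw [Set.indicator_of_mem hi, if_pos (Set.mem_Icc.1 hi)]
  · rw [Set.indicator_of_notMem hi, if_neg (fun h => hi (Set.mem_Icc.2 h)), zero_smul]

theorem IsSpreading.norm_unitVector (h : IsSpreading 𝓕) (hf : ∀ i, ‖f i‖ = 1) (i : ℕ+) :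
    ‖unitVector (𝕜 := 𝕜) (intervalSeminorm (𝕜 := 𝕜) 𝓕 f) i‖ = 1 := by
  have he : ‖f i‖ₑ = 1 := by rw [← ofReal_norm, hf, ENNReal.ofReal_one]
  suffices ‖unitVector (𝕜 := 𝕜) (intervalSeminorm (𝕜 := 𝕜) 𝓕 f) i‖ₑ = 1 by
    rw [← toReal_enorm, this, ENNReal.toReal_one]
  rw [← toCompletion_single_one, enorm_toCompletion]
  refine le_antisymm ((intervalENorm_le_tsum _ _).trans_eq ?_) ?_
  · rw [tsum_eq_single i fun j hj => by simp [Finsupp.single_eq_of_ne hj]]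
    simp [he]
  · refine le_trans (le_of_eq ?_) (h.enorm_sum_le_intervalENorm _ (le_refl i))
    simp [he]

/-- The one-point interval `{i}` contributes `‖a i • f i‖ = ‖a i‖`. This makes the coordinate
functionals extend to the completion. -/
theorem IsSpreading.norm_apply_le (h : IsSpreading 𝓕) (hf : ∀ i, ‖f i‖ = 1) (i : ℕ+)
    (a : ℕ+ →₀ 𝕜) : ‖a i‖ ≤ ‖toCompletion (intervalSeminorm (𝕜 := 𝕜) 𝓕 f) a‖ := by
  rw [← enorm_le_iff_norm_le, enorm_toCompletion]
  refine le_trans (le_of_eq ?_) (h.enorm_sum_le_intervalENorm _ (le_refl i))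
  rw [Finset.Icc_self, Finset.sum_singleton, enorm_smul, ← ofReal_norm (f i), hf,
    ENNReal.ofReal_one, mul_one]

theorem IsSpreading.norm_linearCombination_le (h : IsSpreading 𝓕) (a : ℕ+ →₀ 𝕜) :
    ‖Finsupp.linearCombination 𝕜 f a‖ ≤ ‖toCompletion (intervalSeminorm (𝕜 := 𝕜) 𝓕 f) a‖ := by
  rw [← enorm_le_iff_norm_le, enorm_toCompletion]
  obtain ⟨N, hN⟩ := exists_sum_Icc_single_eq a
  refine le_trans (le_of_eq ?_) (h.enorm_sum_le_intervalENorm _ (one_le (a := N)))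
  conv_lhs => rw [← hN N le_rfl, map_sum]
  simp

variable (𝕜 𝓕 f) in
/-- The `i`-th coordinate functional on the completion of `c₀₀`. -/
noncomputable def coordinate (i : ℕ+) :
    Completion (C00 (intervalSeminorm (𝕜 := 𝕜) 𝓕 f)) →L[𝕜] 𝕜 :=
  extendCompletion (intervalSeminorm (𝕜 := 𝕜) 𝓕 f) (Finsupp.lapply i)

theorem IsSpreading.coordinate_toCompletion (h : IsSpreading 𝓕) (hf : ∀ i, ‖f i‖ = 1) (i : ℕ+)
    (a : ℕ+ →₀ 𝕜) :
    coordinate 𝕜 𝓕 f i (toCompletion (intervalSeminorm (𝕜 := 𝕜) 𝓕 f) a) = a i :=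
  extendCompletion_toCompletion (h.norm_apply_le hf i) a

theorem IsSpreading.norm_sum_coordinate_le (h : IsSpreading 𝓕) (hf : ∀ i, ‖f i‖ = 1) (p q : ℕ+)
    (g : Completion (C00 (intervalSeminorm (𝕜 := 𝕜) 𝓕 f))) :
    ‖∑ i ∈ Finset.Icc p q, coordinate 𝕜 𝓕 f i g • unitVector (intervalSeminorm (𝕜 := 𝕜) 𝓕 f) i‖ ≤
      ‖g‖ := by
  refine (denseRange_toCompletion (intervalSeminorm (𝕜 := 𝕜) 𝓕 f)).induction_on
    (p := fun g => ‖∑ i ∈ Finset.Icc p q,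
      coordinate 𝕜 𝓕 f i g • unitVector (intervalSeminorm (𝕜 := 𝕜) 𝓕 f) i‖ ≤ ‖g‖) g
    (isClosed_le (by fun_prop) continuous_norm) fun a => ?_
  simp only [h.coordinate_toCompletion hf]
  rw [← enorm_le_iff_norm_le, enorm_sum_Icc_unitVector, enorm_toCompletion]
  exact h.intervalENorm_indicator_le _ p q

/-- The partial sum operators are contractions and eventually fix each finitely supported vector;
such vectors are dense. -/
theorem IsSpreading.tendsto_sum_coordinate (h : IsSpreading 𝓕) (hf : ∀ i, ‖f i‖ = 1)
    (g : Completion (C00 (intervalSeminorm (𝕜 := 𝕜) 𝓕 f))) :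
    Tendsto (fun n : ℕ+ => ∑ i ∈ Finset.Icc 1 n,
      coordinate 𝕜 𝓕 f i g • unitVector (intervalSeminorm (𝕜 := 𝕜) 𝓕 f) i) atTop (𝓝 g) := by
  refine Metric.tendsto_atTop.2 fun ε hε => ?_
  obtain ⟨a, ha⟩ := (denseRange_toCompletion (intervalSeminorm (𝕜 := 𝕜) 𝓕 f)).exists_dist_lt g
    (half_pos hε)
  obtain ⟨N, hN⟩ := exists_sum_Icc_single_eq a
  refine ⟨N, fun n hn => ?_⟩
  have hS : ∑ i ∈ Finset.Icc 1 n, coordinate 𝕜 𝓕 f i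
      (toCompletion (intervalSeminorm (𝕜 := 𝕜) 𝓕 f) a) •
        unitVector (intervalSeminorm (𝕜 := 𝕜) 𝓕 f) i =
      toCompletion (intervalSeminorm (𝕜 := 𝕜) 𝓕 f) a := by
    simp only [h.coordinate_toCompletion hf]
    rw [← toCompletion_sum_single, hN n hn]
  have hle := h.norm_sum_coordinate_le hf 1 n (g - toCompletion (intervalSeminorm (𝕜 := 𝕜) 𝓕 f) a)
  simp only [map_sub, sub_smul, Finset.sum_sub_distrib, hS] at hle
  rw [← dist_eq_norm, ← dist_eq_norm] at hle
  calc _ ≤ _ := dist_triangle _ (toCompletion (intervalSeminorm (𝕜 := 𝕜) 𝓕 f) a) _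
    _ < ε / 2 + ε / 2 := add_lt_add (hle.trans_lt ha) (by rwa [dist_comm])
    _ = ε := add_halves ε

/-- The Schauder basis `(eᵢ)` of the completion of `c₀₀` in the interval norm. -/
noncomputable def IsSpreading.schauderBasis (h : IsSpreading 𝓕) (hf : ∀ i, ‖f i‖ = 1) :
    GeneralSchauderBasis ℕ+ 𝕜 (Completion (C00 (intervalSeminorm (𝕜 := 𝕜) 𝓕 f)))
      (SummationFilter.conditional ℕ+) where
  basis := unitVector (intervalSeminorm (𝕜 := 𝕜) 𝓕 f)
  coord := coordinate 𝕜 𝓕 f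
  ortho i j := by
    rw [← toCompletion_single_one, h.coordinate_toCompletion hf]
    simp [Finsupp.single_apply, Pi.single_apply, eq_comm]
  expansion g := by
    rw [HasSum, SummationFilter.conditional_filter_eq_map_Iic, tendsto_map'_iff]
    exact h.tendsto_sum_coordinate hf g

theorem IsSpreading.norm_proj_Icc_le (h : IsSpreading 𝓕) (hf : ∀ i, ‖f i‖ = 1) (p q : ℕ+) :
    ‖(h.schauderBasis (𝕜 := 𝕜) hf).proj (Finset.Icc p q)‖ ≤ 1 := by
  refine ContinuousLinearMap.opNorm_le_bound _ zero_le_one fun g => ?_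
  rw [one_mul, GeneralSchauderBasis.proj_apply]
  exact h.norm_sum_coordinate_le hf p q g

/-! ### Bounded completeness -/

theorem IsSpreading.norm_sq_add_norm_sub_sq_le (h : IsSpreading 𝓕) (a : ℕ+ → 𝕜) {m n : ℕ+}
    (hmn : m ≤ n) :
    ‖∑ i ∈ Finset.Icc 1 m, a i • unitVector (intervalSeminorm (𝕜 := 𝕜) 𝓕 f) i‖ ^ 2 +
      ‖∑ i ∈ Finset.Icc 1 n, a i • unitVector (intervalSeminorm (𝕜 := 𝕜) 𝓕 f) i -
        ∑ i ∈ Finset.Icc 1 m, a i • unitVector (intervalSeminorm (𝕜 := 𝕜) 𝓕 f) i‖ ^ 2 ≤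
      ‖∑ i ∈ Finset.Icc 1 n, a i • unitVector (intervalSeminorm (𝕜 := 𝕜) 𝓕 f) i‖ ^ 2 := by
  have hsplit : ∑ i ∈ Finset.Icc 1 n, a i • unitVector (intervalSeminorm (𝕜 := 𝕜) 𝓕 f) i =
      ∑ i ∈ Finset.Icc 1 m, a i • unitVector (intervalSeminorm (𝕜 := 𝕜) 𝓕 f) i +
        ∑ i ∈ Finset.Icc (m + 1) n, a i • unitVector (intervalSeminorm (𝕜 := 𝕜) 𝓕 f) i := by
    rw [← Finset.sum_union]
    · congr 1
      ext i
      simp only [Finset.mem_union, Finset.mem_Icc, PNat.add_one_le_iff]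
      refine ⟨fun hi => ?_, ?_⟩
      · rcases le_or_gt i m with him | him
        · exact Or.inl ⟨hi.1, him⟩
        · exact Or.inr ⟨him, hi.2⟩
      · rintro (⟨h1, h2⟩ | ⟨h1, h2⟩)
        · exact ⟨h1, h2.trans hmn⟩
        · exact ⟨one_le, h2⟩
    · refine Finset.disjoint_left.2 fun i hi hi' => ?_
      exact absurd (Finset.mem_Icc.1 hi).2
        (not_le.2 (PNat.add_one_le_iff.1 (Finset.mem_Icc.1 hi').1))
  rw [eq_sub_of_add_eq' hsplit.symm |>.symm]
  have key := h.intervalENorm_sq_add_le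
    (Set.indicator (Set.Icc 1 n) fun i => a i • f i) (P := 1) (Q := m) (P' := m + 1) (Q' := n)
    (PNat.lt_add_right m 1)
  rw [Set.indicator_indicator, Set.indicator_indicator,
    Set.inter_eq_left.2 (Set.Icc_subset_Icc_right hmn),
    Set.inter_eq_left.2 (Set.Icc_subset_Icc_left one_le),
    ← enorm_sum_Icc_unitVector, ← enorm_sum_Icc_unitVector, ← enorm_sum_Icc_unitVector] at key
  have := ENNReal.toReal_mono (by finiteness) key
  rwa [ENNReal.toReal_add (by finiteness) (by finiteness), ENNReal.toReal_pow,
    ENNReal.toReal_pow, ENNReal.toReal_pow, toReal_enorm, toReal_enorm, toReal_enorm] at this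

theorem IsSpreading.isBoundedlyComplete (h : IsSpreading 𝓕) :
    IsBoundedlyComplete 𝕜 (unitVector (intervalSeminorm (𝕜 := 𝕜) 𝓕 f)) := by
  rintro a ⟨C, hC⟩
  set S : ℕ+ → Completion (C00 (intervalSeminorm (𝕜 := 𝕜) 𝓕 f)) := fun n =>
    ∑ i ∈ Finset.Icc 1 n, a i • unitVector (intervalSeminorm (𝕜 := 𝕜) 𝓕 f) i with hS
  have hbdd : BddAbove (range fun n => ‖S n‖ ^ 2) := by
    refine ⟨C ^ 2, ?_⟩
    rintro _ ⟨n, rfl⟩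
    exact pow_le_pow_left₀ (norm_nonneg _) (hC n) 2
  refine cauchySeq_tendsto_of_complete (Metric.cauchySeq_iff'.2 fun ε hε => ?_)
  -- With `‖S N‖²` within `ε²` of the supremum, the lower `2`-estimate leaves less than `ε²` for `‖S
  -- n - S N‖²`.
  obtain ⟨N, hN⟩ := exists_lt_of_lt_ciSup
    (sub_lt_self (⨆ n, ‖S n‖ ^ 2) (pow_pos hε 2))
  refine ⟨N, fun n hn => ?_⟩
  have h1 : ‖S N‖ ^ 2 + ‖S n - S N‖ ^ 2 ≤ ‖S n‖ ^ 2 :=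
    h.norm_sq_add_norm_sub_sq_le (f := f) a hn
  have h2 := le_ciSup hbdd n
  rw [dist_eq_norm]
  refine lt_of_pow_lt_pow_left₀ 2 hε.le ?_
  linarith

/-! ### The quotient map -/

variable [CompleteSpace X]

variable (𝕜 𝓕 f) in
/-- The linear map from the completion of `c₀₀` in the interval norm which sends `eᵢ` to `fᵢ`. -/
noncomputable def quotientMap : Completion (C00 (intervalSeminorm (𝕜 := 𝕜) 𝓕 f)) →L[𝕜] X :=
  extendCompletion (intervalSeminorm (𝕜 := 𝕜) 𝓕 f) (Finsupp.linearCombination 𝕜 f)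

theorem IsSpreading.quotientMap_unitVector (h : IsSpreading 𝓕) (i : ℕ+) :
    quotientMap 𝕜 𝓕 f (unitVector (intervalSeminorm (𝕜 := 𝕜) 𝓕 f) i) = f i := by
  rw [← toCompletion_single_one]
  refine (extendCompletion_toCompletion h.norm_linearCombination_le _).trans ?_
  simp

theorem IsSpreading.norm_quotientMap_apply_le (h : IsSpreading 𝓕)
    (g : Completion (C00 (intervalSeminorm (𝕜 := 𝕜) 𝓕 f))) : ‖quotientMap 𝕜 𝓕 f g‖ ≤ ‖g‖ :=
  norm_extendCompletion_apply_le h.norm_linearCombination_le g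

theorem IsSpreading.norm_quotientMap (h : IsSpreading 𝓕) (hf : ∀ i, ‖f i‖ = 1) :
    ‖quotientMap 𝕜 𝓕 f‖ = 1 := by
  refine le_antisymm (ContinuousLinearMap.opNorm_le_bound _ zero_le_one fun g => ?_) ?_
  · rw [one_mul]
    exact h.norm_quotientMap_apply_le g
  · have := (quotientMap 𝕜 𝓕 f).le_opNorm (unitVector (intervalSeminorm (𝕜 := 𝕜) 𝓕 f) 1)
    rwa [h.quotientMap_unitVector, hf, h.norm_unitVector hf, mul_one] at this

theorem IsSpreading.tendsto_quotientMap (h : IsSpreading 𝓕) (a : ℕ+ → 𝕜)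
    (g : Completion (C00 (intervalSeminorm (𝕜 := 𝕜) 𝓕 f)))
    (hg : Tendsto (fun n : ℕ+ => ∑ i ∈ Finset.Icc 1 n,
      a i • unitVector (intervalSeminorm (𝕜 := 𝕜) 𝓕 f) i) atTop (𝓝 g)) :
    Tendsto (fun n : ℕ+ => ∑ i ∈ Finset.Icc 1 n, a i • f i) atTop
      (𝓝 (quotientMap 𝕜 𝓕 f g)) := by
  refine (((quotientMap 𝕜 𝓕 f).continuous.tendsto g).comp hg).congr fun n => ?_
  simp only [Function.comp_apply, map_sum, map_smul, h.quotientMap_unitVector]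

/-- A contraction from a Banach space such that each `y` is approximated, up to any given fraction
of its norm, by the image of a vector whose norm is at most that of `y`, is a quotient map. -/
theorem isQuotientMap_of_forall_exists_approx {Y Z : Type*} [NormedAddCommGroup Y]
    [NormedSpace 𝕜 Y] [CompleteSpace Y] [NormedAddCommGroup Z] [NormedSpace 𝕜 Z] (Q : Y →L[𝕜] Z)
    (hQ : ∀ g, ‖Q g‖ ≤ ‖g‖)
    (happ : ∀ η > (0 : ℝ), ∀ y, ∃ g, ‖g‖ ≤ ‖y‖ ∧ ‖y - Q g‖ ≤ η * ‖y‖) : IsQuotientMap 𝕜 Q := by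
  refine Set.Subset.antisymm ?_ fun y hy => ?_
  · rintro _ ⟨g, hg, rfl⟩
    rw [mem_ball_zero_iff] at hg ⊢
    exact (hQ g).trans_lt hg
  rw [mem_ball_zero_iff] at hy
  -- The preimage built below has norm at most `‖y‖ / (1 - η)`; this choice gives `1 - η = (1 + ‖y‖)
  -- / 2 > ‖y‖`, so the bound is less than `1`.
  set η : ℝ := (1 - ‖y‖) / 2 with hη
  have hη0 : 0 < η := by rw [hη]; linarith
  have hη1 : η < 1 := by rw [hη]; linarith [norm_nonneg y]
  choose G hG hGQ using happ η hη0
  -- `r n` is the error left after `n` corrections; each correction shrinks it by the factor `η`.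
  let r : ℕ → Z := fun n => (fun z => z - Q (G z))^[n] y
  have hr0 : r 0 = y := rfl
  have hrs : ∀ n, r (n + 1) = r n - Q (G (r n)) := fun n => Function.iterate_succ_apply' _ _ _
  have hrn : ∀ n, ‖r n‖ ≤ ‖y‖ * η ^ n := by
    intro n
    induction n with
    | zero => simp [hr0]
    | succ n ih =>
      rw [hrs]
      calc _ ≤ η * ‖r n‖ := hGQ _
        _ ≤ η * (‖y‖ * η ^ n) := by gcongr
        _ = _ := by ring
  have hgeom := (hasSum_geometric_of_lt_one hη0.le hη1).mul_left ‖y‖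
  have hGr : ∀ n, ‖G (r n)‖ ≤ ‖y‖ * η ^ n := fun n => (hG _).trans (hrn n)
  have hsum : Summable fun n => G (r n) := Summable.of_norm_bounded hgeom.summable hGr
  refine ⟨∑' n, G (r n), ?_, ?_⟩
  · rw [mem_ball_zero_iff]
    refine (tsum_of_norm_bounded hgeom hGr).trans_lt ?_
    rw [← div_eq_mul_inv, div_lt_one (by linarith), hη]
    linarith
  · have hpart : ∀ n, Q (∑ k ∈ Finset.range n, G (r k)) = y - r n := by
      intro n
      induction n with
      | zero => simp [hr0]
      | succ n ih =>
        rw [Finset.sum_range_succ, map_add, ih, hrs]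
        abel
    have hr : Tendsto r atTop (𝓝 0) := by
      refine squeeze_zero_norm hrn ?_
      simpa using (tendsto_pow_atTop_nhds_zero_of_lt_one hη0.le hη1).const_mul ‖y‖
    have h1 : Tendsto (fun n => Q (∑ k ∈ Finset.range n, G (r k))) atTop
        (𝓝 (Q (∑' n, G (r n)))) :=
      (Q.continuous.tendsto _).comp hsum.hasSum.tendsto_sum_nat
    simp only [hpart] at h1
    have h2 : Tendsto (fun n => y - r n) atTop (𝓝 y) := by
      simpa using tendsto_const_nhds.sub hr
    exact tendsto_nhds_unique h1 h2

theorem IsSpreading.isQuotientMap_quotientMap (h : IsSpreading 𝓕) (hf : ∀ i, ‖f i‖ = 1)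
    (hfd : Metric.sphere 0 1 ⊆ closure (range f)) : IsQuotientMap 𝕜 (quotientMap 𝕜 𝓕 f) := by
  refine isQuotientMap_of_forall_exists_approx _ h.norm_quotientMap_apply_le fun η hη y => ?_
  rcases eq_or_ne y 0 with rfl | hy
  · exact ⟨0, by simp⟩
  have hy0 : ‖y‖ ≠ 0 := norm_ne_zero_iff.2 hy
  have hc : (‖y‖ : 𝕜) ≠ 0 := RCLike.ofReal_ne_zero.2 hy0
  have hu : (‖y‖ : 𝕜)⁻¹ • y ∈ Metric.sphere (0 : X) 1 := by
    rw [mem_sphere_zero_iff_norm, norm_smul, norm_inv, RCLike.norm_ofReal, abs_norm,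
      inv_mul_cancel₀ hy0]
  obtain ⟨_, ⟨i, rfl⟩, hi⟩ := Metric.mem_closure_iff.1 (hfd hu) η hη
  -- Here `f i` is within `η` of the normalized vector `y / ‖y‖`; scaling by `‖y‖` gives the
  -- approximation.
  refine ⟨(‖y‖ : 𝕜) • unitVector (intervalSeminorm (𝕜 := 𝕜) 𝓕 f) i, ?_, ?_⟩
  · rw [norm_smul, h.norm_unitVector hf, RCLike.norm_ofReal, abs_norm, mul_one]
  · have : y - quotientMap 𝕜 𝓕 f ((‖y‖ : 𝕜) • unitVector (intervalSeminorm (𝕜 := 𝕜) 𝓕 f) i) =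
        (‖y‖ : 𝕜) • ((‖y‖ : 𝕜)⁻¹ • y - f i) := by
      rw [map_smul, h.quotientMap_unitVector, smul_sub, smul_inv_smul₀ hc]
    rw [this, norm_smul, RCLike.norm_ofReal, abs_norm, mul_comm, ← dist_eq_norm]
    gcongr

end IntervalSpace

end Lindenstrauss

theorem proposition3p2 {𝕜 : Type*} [RCLike 𝕜]
    (s : Ordinal.{0} → ℕ+ → Ordinal.{0}) (hs : Lindenstrauss.IsFundamentalSystem s)
    (α β : Ordinal.{0}) (hα : α < Ordinal.omega 1) (hβ : β < Ordinal.omega 1)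
    (f : ℕ+ → Lindenstrauss.SchreierSpace 𝕜 s α) (hf : ∀ i, ‖f i‖ = 1)
    (hfd : Metric.sphere 0 1 ⊆ closure (range f)) :
    (∃ b : GeneralSchauderBasis ℕ+ 𝕜 (Lindenstrauss.GSpace s α β f)
        (SummationFilter.conditional ℕ+),
      (∀ i, b.basis i = Lindenstrauss.unitVector (Lindenstrauss.gNorm s α β f) i) ∧
      (∀ i, ‖b.basis i‖ = 1) ∧
      (∀ p q : ℕ+, ‖b.proj (Finset.Icc p q)‖ ≤ 1) ∧
      Lindenstrauss.IsBoundedlyComplete 𝕜 b.basis) ∧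
    (∃ Q : Lindenstrauss.GSpace s α β f →L[𝕜] Lindenstrauss.SchreierSpace 𝕜 s α,
      (∀ (a : ℕ+ → 𝕜) (g : Lindenstrauss.GSpace s α β f),
        Tendsto (fun n : ℕ+ => ∑ i ∈ Finset.Icc 1 n,
          a i • Lindenstrauss.unitVector (Lindenstrauss.gNorm s α β f) i) atTop (𝓝 g) →
        Tendsto (fun n : ℕ+ => ∑ i ∈ Finset.Icc 1 n, a i • f i) atTop (𝓝 (Q g))) ∧
      ‖Q‖ = 1 ∧ Lindenstrauss.IsQuotientMap 𝕜 Q) := by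
  have h := Lindenstrauss.isSpreading_schreierFamily hs hβ
  exact ⟨⟨h.schauderBasis hf, fun _ => rfl, h.norm_unitVector hf, h.norm_proj_Icc_le hf,
    h.isBoundedlyComplete⟩, Lindenstrauss.quotientMap 𝕜 _ f, h.tendsto_quotientMap,
    h.norm_quotientMap hf, h.isQuotientMap_quotientMap hf hfd⟩
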